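/- **Setting.** A multi-player mean-payoff game arena consists of a finite set $P$ of players with a leader $l\in P$ (the others are followers), a finite set $V$ of vertices with an initial vertex $v_0$, a partition $(V_p)_{p\in P}$ of $V$ (blocks may be empty), an edge relation $E\subseteq V\times V$ such that every vertex has a successor, and rewards $r_p:E\to\mathbb Q$ for $p\in P$. Histories are finite plays from $v_0$. A strategy of $p$ maps each history ending in $V_p$ to a successor of its last vertex; a strategy profile $\sigma=(\sigma_p)_{p\in P}$ defines a play $\pi_\sigma$, and $\sigma_{p,\tau}$ is $\sigma$ with $p$'s strategy replaced by $\tau$. An incentive profile $\gamma$ gives to each follower $p$ a function $\gamma_p$ from histories to $\mathbb R_{\ge0}$. For a play $\pi=v_0v_1\dots$ let $r_p(\pi)=\liminf_n\frac1n\sum_{i<n}r_p(v_i,v_{i+1})$ and $\gamma_p(\pi)=\liminf_n\frac1n\sum_{i<n}\gamma_p(v_0\dots v_i)\in[0,\infty]$. The payoff is $r_p(\pi)+\gamma_p(\pi)$ for a follower $p$ and $r_l(\pi)-\sum_{p\ne l}\gamma_p(\pi)$ for the leader. $(\sigma,\gamma)$ is an *incentive strategy profile* (ISP) if no follower $p$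 has a strategy $\tau$ such that his payoff on $\pi_{\sigma_{p,\tau}}$ exceeds his payoff on $\pi_\sigma$. It is an *incentive equilibrium* (an *$\varepsilon$-incentive equilibrium*) if it is an ISP and no ISP gives the leader a larger payoff (a payoff larger by more than $\varepsilon$). It is *secure* if it is an ISP and, for every follower $p$ and every $\tau$, the deviation to $\tau$ gives $p$ a strictly lower payoff, or the same payoff and every other player, including the leader, at least the same payoff as before. It is *subgame perfect* if it induces an ISP in the subgame after every history, and *secure subgame perfect* if it induces a secure ISP in the subgame after every history. The profile $\sigma$ is *well behaved* if every edge occurs on $\pi_\sigma$ with a limit frequency. A history is *deviating* if it is not a prefix of $\pi_\sigma$; its *last deviator* is the owner of the vertex at which it last departs from $\sigma$. Let $\mathcal G_q$ be the two-player mean-payoff game in which $q$ has reward $r_q$ and the coalition of all other players has reward $-r_q$; let $r_{\max}$ be the largest reward of any player on any edge. $(\sigma,\gamma)$ is a *perfectly-incentivised strategy profile* (PSP) if (i) for each follower $p$, $\gamma_p$ is constant on the prefixes of $\pi_\sigma$; (ii) there are optimal positional strategies of both sides in the games $\mathcal G_q$ such that, on every deviating history with last deviator $q$, all players move according to those for $\mathcal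 G_q$; (iii) if $h$ is a deviating history with last deviator $q$ whose last vertex $v$ belongs to a follower $p\neq q$, and $v'$ is the move $\sigma$ prescribes at $h$, then $r_p(v,v')+\gamma_p(h\cdot v')=r_{\max}+1$; (iv) all other incentives on deviating histories are $0$. **Theorem.** For every multi-player mean-payoff game arena and every $\varepsilon>0$ there are a strategy profile $\sigma$ and incentive profiles $\gamma,\gamma'$ such that 1. $\sigma$ is well behaved, and $(\sigma,\gamma)$ is a PSP and an incentive equilibrium; 2. $\gamma'$ raises every follower's incentive along the play by $\varepsilon/|P|$: $\gamma'_p(h)=\gamma_p(h)+\varepsilon/|P|$ for every follower $p$ and every prefix $h$ of $\pi_\sigma$; 3. $(\sigma,\gamma')$ is an $\varepsilon$-incentive equilibrium, subgame perfect, and secure subgame perfect; 4. in $(\sigma,\gamma')$, every follower whose unilateral deviation changes the play receives a strictly lower payoff than without the deviation. -/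

import Mathlib

open Filter Topology
open scoped NNReal

/-- Multi-player mean-payoff game arena with set of players `P` and set of vertices `V` (both are
assumed finite in the theorem).  The partition of the vertices is given by the function `owner`.
Only the values of `reward` on edges are ever used. -/
structure Arena (P V : Type*) where
  leader : P
  init : V
  owner : V → P
  Edge : V → V → Prop
  exists_edge : ∀ v, ∃ w, Edge v w
  reward : P → V → V → ℚ

namespace Arena

variable {P V : Type*}

/-- A history `v₀ … vₙ` is written as a pair: the list `[v₀, …, vₙ₋₁]` of past vertices and the
current vertex `vₙ`.  It is a finite play if it starts in the initial vertex and follows edges. -/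
def IsFinitePlay (G : Arena P V) (past : List V) (v : V) : Prop :=
  (past ++ [v]).head? = some G.init ∧ (past ++ [v]).IsChain G.Edge

/-- An infinite path in the graph of the arena (from any vertex). -/
def IsPath (G : Arena P V) (π : ℕ → V) : Prop := ∀ i, G.Edge (π i) (π (i + 1))

/-- A (pure, history dependent) strategy of player `p`: a successor for every history that ends in
a vertex of `p`.  (Values at histories ending in vertices of other players are never used.) -/
structure Strategy (G : Arena P V) (p : P) where
  move : List V → V → V
  legal : ∀ past v, G.owner v = p → G.Edge v (move past v)

/-- A strategy profile: one strategy for each player. -/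
abbrev Profile (G : Arena P V) := ∀ p, G.Strategy p

/-- An incentive profile: for each follower, a function from histories to nonnegative reals.
(The component of the leader is never used.) -/
abbrev Incentives (_G : Arena P V) := P → List V → V → ℝ≥0

variable (G : Arena P V)

/-- The successor that the profile prescribes at a history. -/
def next (σ : G.Profile) (past : List V) (v : V) : V := (σ (G.owner v)).move past v

/-- The history after `n` moves when all players follow `σ`. -/
def run (σ : G.Profile) : ℕ → List V × V
  | 0 => ([], G.init)
  | n + 1 => ((run σ n).1 ++ [(run σ n).2], G.next σ (run σ n).1 (run σ n).2)

/-- The play defined by `σ`. -/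
def play (σ : G.Profile) (n : ℕ) : V := (G.run σ n).2

open Classical in
/-- The profile in which player `p` unilaterally switches to the strategy `τ`. -/
noncomputable def deviate (σ : G.Profile) (p : P) (τ : G.Strategy p) : G.Profile :=
  Function.update σ p τ

end Arena

/-- The limit average (limes inferior of the averages) of a real sequence, in `[-∞, ∞]`. -/
noncomputable def limAvg (a : ℕ → ℝ) : EReal :=
  liminf (fun n : ℕ => (((∑ i ∈ Finset.range n, a i) / n : ℝ) : EReal)) atTop

namespace Arena

variable {P V : Type*} (G : Arena P V)

/-- Raw payoff of player `p` on an infinite path. -/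
noncomputable def rawPayoff (p : P) (π : ℕ → V) : EReal :=
  limAvg fun i => (G.reward p (π i) (π (i + 1)) : ℝ)

/-- Incentive of player `p` on an infinite play, paid at each of its prefixes `v₀ … vᵢ`. -/
noncomputable def incentive (γ : G.Incentives) (p : P) (π : ℕ → V) : EReal :=
  limAvg fun i => (γ p ((List.range i).map π) (π i) : ℝ)

open Classical in
/-- Overall payoff: the followers receive their incentives in addition to the raw payoff, the
leader pays them. -/
noncomputable def payoff [Fintype P] (γ : G.Incentives) (p : P) (π : ℕ → V) : EReal :=
  if p = G.leader then
    G.rawPayoff p π - ∑ q ∈ Finset.univ.filter (fun q => q ≠ G.leader), G.incentive γ q π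
  else G.rawPayoff p π + G.incentive γ p π

section Equilibria

variable [Fintype P]

/-- Incentive strategy profile: no follower benefits from a unilateral deviation. -/
def IsISP (σ : G.Profile) (γ : G.Incentives) : Prop :=
  ∀ p, p ≠ G.leader → ∀ τ : G.Strategy p,
    G.payoff γ p (G.play (G.deviate σ p τ)) ≤ G.payoff γ p (G.play σ)

/-- `ε`-incentive equilibrium: an incentive strategy profile that is, for the leader, at most `ε`
worse than every incentive strategy profile. -/
def IsEpsIncentiveEquilibrium (ε : ℝ) (σ : G.Profile) (γ : G.Incentives) : Prop :=
  G.IsISP σ γ ∧ ∀ (σ' : G.Profile) (γ' : G.Incentives), G.IsISP σ' γ' →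
    G.payoff γ' G.leader (G.play σ') - (ε : EReal) ≤ G.payoff γ G.leader (G.play σ)

/-- Incentive equilibrium: optimal for the leader among the incentive strategy profiles. -/
def IsIncentiveEquilibrium (σ : G.Profile) (γ : G.Incentives) : Prop :=
  G.IsISP σ γ ∧ ∀ (σ' : G.Profile) (γ' : G.Incentives), G.IsISP σ' γ' →
    G.payoff γ' G.leader (G.play σ') ≤ G.payoff γ G.leader (G.play σ)

/-- Secure incentive strategy profile: upon unilateral deviation, a follower receives a strictly
lower payoff, or an equal one, and in the latter case every other player (the leader included)
receives at least the same payoff as before. -/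
def IsSecureISP (σ : G.Profile) (γ : G.Incentives) : Prop :=
  G.IsISP σ γ ∧ ∀ p, p ≠ G.leader → ∀ τ : G.Strategy p,
    G.payoff γ p (G.play (G.deviate σ p τ)) < G.payoff γ p (G.play σ) ∨
    (G.payoff γ p (G.play (G.deviate σ p τ)) = G.payoff γ p (G.play σ) ∧
      ∀ q, q ≠ p → G.payoff γ q (G.play σ) ≤ G.payoff γ q (G.play (G.deviate σ p τ)))

end Equilibria

/-! Subgames -/

/-- The same arena with initial vertex `v`. -/
def startAt (v : V) : Arena P V := { G with init := v }

/-- The strategy profile that `σ` induces in the subgame after the history `past · v`. -/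
def subProfile (σ : G.Profile) (past : List V) (v : V) : (G.startAt v).Profile :=
  fun p => { move := fun past' w => (σ p).move (past ++ past') w
             legal := fun past' w hw => (σ p).legal (past ++ past') w hw }

/-- The incentives that `γ` induces in the subgame after the history `past · v`. -/
def subIncentives (γ : G.Incentives) (past : List V) (v : V) : (G.startAt v).Incentives :=
  fun p past' w => γ p (past ++ past') w

/-- Every reachable subgame is an incentive strategy profile. -/
def IsSubgamePerfect [Fintype P] (σ : G.Profile) (γ : G.Incentives) : Prop :=
  ∀ past v, G.IsFinitePlay past v →
    (G.startAt v).IsISP (G.subProfile σ past v) (G.subIncentives γ past v)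

/-- Every reachable subgame is a secure incentive strategy profile. -/
def IsSecureSubgamePerfect [Fintype P] (σ : G.Profile) (γ : G.Incentives) : Prop :=
  ∀ past v, G.IsFinitePlay past v →
    (G.startAt v).IsSecureISP (G.subProfile σ past v) (G.subIncentives γ past v)

/-! Well-behaved and perfectly-incentivised strategy profiles -/

open Classical in
/-- On the play of `σ`, every edge occurs with a limit frequency. -/
def IsWellBehaved (σ : G.Profile) : Prop :=
  ∀ u w, G.Edge u w → ∃ x : ℝ, Tendsto (fun n : ℕ =>
    (((Finset.range n).filter fun i => G.play σ i = u ∧ G.play σ (i + 1) = w).card : ℝ) / n)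
    atTop (𝓝 x)

/-- The finite play `past · v` is not a prefix of the play of `σ`. -/
def IsDeviating (σ : G.Profile) (past : List V) (v : V) : Prop :=
  G.IsFinitePlay past v ∧ ¬ ∃ n, past = (List.range n).map (G.play σ) ∧ v = G.play σ n

/-- `q` is the last player who deviated from `σ` on the history `h`: the last position at which
`h` differs from what `σ` prescribes is owned by `q`. -/
def IsLastDeviator (σ : G.Profile) (h : List V) (q : P) : Prop :=
  ∃ a u w b, h = a ++ u :: w :: b ∧ G.owner u = q ∧ w ≠ G.next σ a u ∧
    ∀ a' u' w' b', h = a' ++ u' :: w' :: b' → a.length < a'.length → w' = G.next σ a' u'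

/-- In the two-player mean-payoff game in which `q` receives his reward and all other players
jointly receive its negative, the positional strategies given by `s` (for `q` at his own vertices,
for the coalition at all others) are optimal from every vertex: they guarantee the value `val v`
to `q`, and `-val v` to the coalition, against every behaviour of the opponent. -/
def IsOptimalPositional (q : P) (s : V → V) : Prop :=
  (∀ v, G.Edge v (s v)) ∧ ∃ val : V → ℝ, ∀ π : ℕ → V, G.IsPath π →
    ((∀ i, G.owner (π i) = q → π (i + 1) = s (π i)) → (val (π 0) : EReal) ≤ G.rawPayoff q π) ∧
    ((∀ i, G.owner (π i) ≠ q → π (i + 1) = s (π i)) →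
      ((-val (π 0) : ℝ) : EReal) ≤ limAvg fun i => (-G.reward q (π i) (π (i + 1)) : ℝ))

/-- The largest reward of any player on any edge. -/
noncomputable def maxReward : ℝ :=
  sSup {x : ℝ | ∃ p u w, G.Edge u w ∧ x = G.reward p u w}

/-- The history `past · v` arises from a deviating history on which `p` owns the last vertex and
is not the last deviator, by the move that `σ` prescribes to `p`. -/
def IsRewarded (σ : G.Profile) (p : P) (past : List V) (v : V) : Prop :=
  ∃ a u q, past = a ++ [u] ∧ G.IsDeviating σ a u ∧ G.IsLastDeviator σ (a ++ [u]) q ∧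
    G.owner u = p ∧ p ≠ q ∧ v = G.next σ a u

/-- Perfectly-incentivised strategy profile. -/
structure IsPSP (σ : G.Profile) (γ : G.Incentives) : Prop where
  /-- the incentives are constant along the play -/
  const : ∀ p, p ≠ G.leader → ∃ c : ℝ≥0, ∀ n, γ p ((List.range n).map (G.play σ)) (G.play σ n) = c
  /-- after a deviation, all players follow optimal positional strategies of the two-player game
  against the last deviator -/
  punish : ∃ s : P → V → V, (∀ q, G.IsOptimalPositional q (s q)) ∧
    ∀ past v q, G.IsDeviating σ past v → G.IsLastDeviator σ (past ++ [v]) q →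
      G.next σ past v = s q v
  /-- a follower other than the last deviator is rewarded for a prescribed punishing move -/
  reward : ∀ p, p ≠ G.leader → ∀ past u v, G.IsRewarded σ p (past ++ [u]) v →
    (G.reward p u v : ℝ) + γ p (past ++ [u]) v = G.maxReward + 1
  /-- on deviating histories there are no other incentives -/
  zero : ∀ p, p ≠ G.leader → ∀ past v, G.IsDeviating σ past v → ¬ G.IsRewarded σ p past v →
    γ p past v = 0

end Arena

/-! ### Limit averages -/

/-! Let val_p(v) be the value of the two-player game of `p` against all others from `v`. In an ISP,
a follower may follow his strategy up to any vertex of the play and then switch to an optimal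
positional strategy, so his payoff is at least val_p at every visited vertex (`IsISP.le_payoff`).
Conversely, if a play and constant incentives meet these bounds, punishing the last deviator by the
optimal coalition strategy supports the play: a deviator is held to the value of the vertex at which
he leaves it (`isISP_punishProfile`). Writing m_p for the maximum of val_p on the visited vertices,
the cheapest constant incentive is max(0, m_p - r_p), and the leader's problem is to maximise r_l
minus the sum of these over all plays.

This maximum is attained (`exists_optimal_play`). A play returns infinitely often to some vertex,
and a limit of the edge frequencies of its loops there is at least as good for every reward
simultaneously (`exists_mem_closure_of_path`); conversely every limit of frequencies of closed walks
is the frequency vector of a path (`exists_path_of_mem_closure`). For a fixed vertex set and base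
vertex these limits form a compact set on which the objective is continuous, and there are only
finitely many such pairs. The resulting play has limit frequencies, so it is well behaved.

Positional determinacy comes from discounted games by letting the discount vanish
(`exists_gain_bias`).

For the perturbed incentives only the values along the play are prescribed. Off the play they are
redesigned so that every deviation which changes the play is strictly worse in every subgame
(`payoff_lt_of_deviation`); this gives subgame perfection, security and strictness together. -/

theorem coe_le_limAvg {a : ℕ → ℝ} {c : ℝ} (K : ℝ)
    (h : ∀ n : ℕ, c * n - K ≤ ∑ i ∈ Finset.range n, a i) : (c : EReal) ≤ limAvg a := by
  have h0 : Tendsto (fun n : ℕ => ((c - K / n : ℝ) : EReal)) atTop (𝓝 (c : EReal)) := by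
    rw [EReal.tendsto_coe]
    simpa using (tendsto_const_nhds (x := c)).sub (tendsto_const_div_atTop_nhds_zero_nat K)
  rw [← h0.liminf_eq]
  refine liminf_le_liminf ?_
  filter_upwards [eventually_gt_atTop 0] with n hn
  have hn' : (0 : ℝ) < n := by exact_mod_cast hn
  rw [EReal.coe_le_coe_iff, le_div_iff₀ hn']
  have := h n
  field_simp
  linarith

theorem limAvg_le_coe {a : ℕ → ℝ} {c : ℝ} (K : ℝ)
    (h : ∀ n : ℕ, ∑ i ∈ Finset.range n, a i ≤ c * n + K) : limAvg a ≤ (c : EReal) := by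
  have h0 : Tendsto (fun n : ℕ => ((c + K / n : ℝ) : EReal)) atTop (𝓝 (c : EReal)) := by
    rw [EReal.tendsto_coe]
    simpa using (tendsto_const_nhds (x := c)).add (tendsto_const_div_atTop_nhds_zero_nat K)
  rw [← h0.liminf_eq]
  refine liminf_le_liminf ?_
  filter_upwards [eventually_gt_atTop 0] with n hn
  have hn' : (0 : ℝ) < n := by exact_mod_cast hn
  rw [EReal.coe_le_coe_iff, div_le_iff₀ hn']
  have := h n
  field_simp
  linarith

theorem sum_range_le_of_eventually {a : ℕ → ℝ} {c : ℝ} {N : ℕ} (h : ∀ i, N ≤ i → a i ≤ c) :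
    ∃ K : ℝ, ∀ n : ℕ, ∑ i ∈ Finset.range n, a i ≤ c * n + K := by
  refine ⟨∑ i ∈ Finset.range N, |a i - c|, fun n => ?_⟩
  have h1 : ∑ i ∈ Finset.range n, (a i - c) ≤ ∑ i ∈ Finset.range N, |a i - c| := by
    calc ∑ i ∈ Finset.range n, (a i - c)
        ≤ ∑ i ∈ Finset.range n, if i < N then |a i - c| else 0 := by
          refine Finset.sum_le_sum fun i _ => ?_
          split_ifs with hi
          · exact le_abs_self _
          · linarith [h i (not_lt.1 hi)]
      _ = ∑ i ∈ (Finset.range n).filter (· < N), |a i - c| := by rw [Finset.sum_filter]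
      _ ≤ _ := by
          refine Finset.sum_le_sum_of_subset_of_nonneg ?_ fun _ _ _ => abs_nonneg _
          intro i hi
          simpa using (Finset.mem_filter.1 hi).2
  simp only [Finset.sum_sub_distrib, Finset.sum_const, Finset.card_range, nsmul_eq_mul] at h1
  linarith

theorem limAvg_le_of_eventually {a : ℕ → ℝ} {c : ℝ} {N : ℕ} (h : ∀ i, N ≤ i → a i ≤ c) :
    limAvg a ≤ (c : EReal) := by
  obtain ⟨K, hK⟩ := sum_range_le_of_eventually h
  exact limAvg_le_coe K hK

theorem le_limAvg_of_eventually {a : ℕ → ℝ} {c : ℝ} {N : ℕ} (h : ∀ i, N ≤ i → c ≤ a i) :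
    (c : EReal) ≤ limAvg a := by
  obtain ⟨K, hK⟩ := sum_range_le_of_eventually (a := fun i => - a i) (c := -c) (N := N)
    fun i hi => neg_le_neg (h i hi)
  refine coe_le_limAvg K fun n => ?_
  have := hK n
  rw [Finset.sum_neg_distrib] at this
  linarith

theorem limAvg_const (c : ℝ) : limAvg (fun _ => c) = (c : EReal) :=
  le_antisymm (limAvg_le_of_eventually (N := 0) fun _ _ => le_rfl)
    (le_limAvg_of_eventually (N := 0) fun _ _ => le_rfl)

theorem limAvg_eq_of_tendsto {a : ℕ → ℝ} {c : ℝ}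
    (h : Tendsto (fun n : ℕ => (∑ i ∈ Finset.range n, a i) / n) atTop (𝓝 c)) :
    limAvg a = (c : EReal) := by
  have h' := (EReal.tendsto_coe.2 h)
  exact h'.liminf_eq

/-- The liminf of the negated averages is minus the limsup, so the coalition's guarantee bounds even
the limsup of the averages. -/
theorem limAvg_le_of_neg {a : ℕ → ℝ} {c : ℝ}
    (h : ((-c : ℝ) : EReal) ≤ limAvg fun i => - a i) : limAvg a ≤ (c : EReal) := by
  have h1 : limAvg (fun i => - a i) =
      liminf (-(fun n : ℕ => (((∑ i ∈ Finset.range n, a i) / n : ℝ) : EReal))) atTop := by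
    unfold limAvg
    congr 1
    funext n
    simp [Finset.sum_neg_distrib, neg_div]
  rw [h1, EReal.liminf_neg, EReal.coe_neg, EReal.neg_le_neg_iff] at h
  exact le_trans (liminf_le_limsup) h

theorem limAvg_le_limAvg_of_tendsto {a b : ℕ → ℝ}
    (h : Tendsto (fun n : ℕ => (∑ i ∈ Finset.range n, a i) / n -
      (∑ i ∈ Finset.range n, b i) / n) atTop (𝓝 0)) : limAvg b ≤ limAvg a := by
  have h' : Tendsto (fun n : ℕ => (((∑ i ∈ Finset.range n, a i) / n -
      (∑ i ∈ Finset.range n, b i) / n : ℝ) : EReal)) atTop (𝓝 ((0 : ℝ) : EReal)) :=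
    EReal.tendsto_coe.2 h
  have h0 := h'.liminf_eq
  have := EReal.le_liminf_add (f := atTop)
    (u := fun n : ℕ => (((∑ i ∈ Finset.range n, a i) / n -
      (∑ i ∈ Finset.range n, b i) / n : ℝ) : EReal))
    (v := fun n : ℕ => (((∑ i ∈ Finset.range n, b i) / n : ℝ) : EReal))
  rw [h0, EReal.coe_zero, zero_add] at this
  refine this.trans (le_of_eq ?_)
  unfold limAvg
  congr 1
  funext n
  simp only [Pi.add_apply]
  rw [← EReal.coe_add]
  congr 1
  ring

/-- The two partial sums of length `n` differ by two blocks of `k` terms, hence by at most `2 * k *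
B`, which vanishes after division by `n`. -/
theorem limAvg_shift {a : ℕ → ℝ} {B : ℝ} (hB : ∀ i, |a i| ≤ B) (k : ℕ) :
    limAvg (fun i => a (i + k)) = limAvg a := by
  have key : Tendsto (fun n : ℕ => (∑ i ∈ Finset.range n, a (i + k)) / n -
      (∑ i ∈ Finset.range n, a i) / n) atTop (𝓝 0) := by
    refine squeeze_zero_norm (a := fun n : ℕ => (2 * k * B) / n) (fun n => ?_)
      (tendsto_const_div_atTop_nhds_zero_nat _)
    rw [← sub_div, norm_div, Real.norm_natCast]
    refine div_le_div_of_nonneg_right ?_ (Nat.cast_nonneg n)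
    have h1 : ∀ (m : ℕ) (c : ℕ → ℕ), |∑ i ∈ Finset.range m, a (c i)| ≤ m * B := fun m c => by
      refine (Finset.abs_sum_le_sum_abs _ _).trans ?_
      refine (Finset.sum_le_card_nsmul _ _ B fun i _ => hB _).trans (by simp)
    have h2 : (∑ i ∈ Finset.range n, a (i + k)) - ∑ i ∈ Finset.range n, a i =
        (∑ i ∈ Finset.range k, a (n + i)) - ∑ i ∈ Finset.range k, a i := by
      have e1 := Finset.sum_range_add a n k
      have e2 := Finset.sum_range_add a k n
      rw [add_comm k n] at e2
      have e3 : ∑ i ∈ Finset.range n, a (i + k) = ∑ i ∈ Finset.range n, a (k + i) :=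
        Finset.sum_congr rfl fun i _ => by rw [add_comm]
      linarith
    rw [h2, Real.norm_eq_abs]
    have h3 := h1 k fun i => n + i
    have h4 := h1 k fun i => i
    refine (abs_sub _ _).trans ?_
    linarith
  refine le_antisymm (limAvg_le_limAvg_of_tendsto ?_) (limAvg_le_limAvg_of_tendsto key)
  simpa using key.neg

theorem exists_limAvg_eq_coe {a : ℕ → ℝ} {B : ℝ} (hB : ∀ i, |a i| ≤ B) :
    ∃ R : ℝ, limAvg a = (R : EReal) := by
  have h1 : limAvg a ≤ (B : EReal) :=
    limAvg_le_of_eventually (N := 0) fun i _ => (abs_le.1 (hB i)).2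
  have h2 : ((-B : ℝ) : EReal) ≤ limAvg a :=
    le_limAvg_of_eventually (N := 0) fun i _ => (abs_le.1 (hB i)).1
  refine ⟨(limAvg a).toReal, (EReal.coe_toReal ?_ ?_).symm⟩
  · exact (h1.trans_lt (EReal.coe_lt_top B)).ne
  · exact ((EReal.bot_lt_coe _).trans_le h2).ne'

/-! ### Positional determinacy of mean-payoff games -/

/-- Poisson equation of a self-map of a finite set: every function is the sum of an invariant
function and a coboundary. -/
theorem exists_invariant_add_coboundary {V : Type*} [Finite V] (f : V → V) (g : V → ℝ) :
    ∃ a b : V → ℝ, (∀ v, a (f v) = a v) ∧ ∀ v, g v = a v + b v - b (f v) := by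
  cases nonempty_fintype V
  let T : (V → ℝ) →ₗ[ℝ] (V → ℝ) := LinearMap.id - LinearMap.funLeft ℝ ℝ f
  have hT : ∀ x v, T x v = x v - x (f v) := fun x v => rfl
  -- If `u = T b` is invariant, telescoping gives n u = b - b ∘ f^n, which is bounded in n, so u =
  -- 0. By rank-nullity, kernel and range then span the space.
  have hdis : Disjoint (LinearMap.ker T) (LinearMap.range T) := by
    rw [Submodule.disjoint_def]
    rintro u hu ⟨b, rfl⟩
    have inv : ∀ v, T b (f v) = T b v := fun v => by
      have := congrFun (LinearMap.mem_ker.1 hu) v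
      rw [hT] at this
      simp only [Pi.zero_apply] at this
      linarith
    have hn : ∀ (n : ℕ) v, n * T b v = b v - b (f^[n] v) := fun n => by
      induction n with
      | zero => simp
      | succ n ih =>
        intro v
        have h1 := ih (f v)
        rw [inv, ← Function.iterate_succ_apply] at h1
        have h2 := hT b v
        push_cast
        linarith
    funext v
    by_contra hne
    have hpos : 0 < |T b v| := abs_pos.2 hne
    obtain ⟨n, hn'⟩ := exists_nat_gt ((2 * ‖b‖) / |T b v|)
    rw [div_lt_iff₀ hpos] at hn'
    have h1 : |(n : ℝ) * T b v| ≤ 2 * ‖b‖ := by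
      rw [hn]
      have h2 := norm_le_pi_norm b v
      have h3 := norm_le_pi_norm b (f^[n] v)
      rw [Real.norm_eq_abs] at h2 h3
      exact (abs_sub _ _).trans (by linarith)
    rw [abs_mul, Nat.abs_cast] at h1
    linarith
  have htop := Submodule.eq_top_of_disjoint (LinearMap.ker T) (LinearMap.range T)
    (by rw [add_comm]; exact (LinearMap.finrank_range_add_finrank_ker T).ge) hdis
  have hg : g ∈ LinearMap.ker T ⊔ LinearMap.range T := htop ▸ Submodule.mem_top
  obtain ⟨a, ha, c, ⟨b, rfl⟩, rfl⟩ := Submodule.mem_sup.1 hg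
  refine ⟨a, b, fun v => ?_, fun v => ?_⟩
  · have := congrFun (LinearMap.mem_ker.1 ha) v
    rw [hT] at this
    simp only [Pi.zero_apply] at this
    linarith
  · rw [Pi.add_apply, hT]
    ring

section Determinacy

variable {V : Type*} [Finite V] (E : V → V → Prop) (hE : ∀ v, ∃ w, E v w) (r : V → V → ℝ)
  (e : V → ℝ)

include hE in
/-- Discounted two-player games have a value with positional optimal strategies.  The sign `e v`
is `1` at vertices of the maximizer and `-1` at vertices of the minimizer. -/
theorem exists_discounted_value (he : ∀ v, e v = 1 ∨ e v = -1) {β : ℝ} (h0 : 0 ≤ β)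
    (h1 : β < 1) : ∃ (s : V → V) (x : V → ℝ), (∀ v, E v (s v)) ∧
      (∀ v, x v = r v (s v) + β * x (s v)) ∧
      ∀ v w, E v w → e v * (r v w + β * x w) ≤ e v * x v := by
  classical
  cases nonempty_fintype V
  let S : V → Finset V := fun v => Finset.univ.filter (E v)
  have hS : ∀ v, (S v).Nonempty := fun v => by
    obtain ⟨w, hw⟩ := hE v
    exact ⟨w, by simp [S, hw]⟩
  -- The Bellman operator: the sign `e v` turns the minimum at the minimizer's vertices into a
  -- maximum, so both players are treated alike.
  let T : (V → ℝ) → V → ℝ := fun x v => e v * (S v).sup' (hS v) fun w => e v * (r v w + β * x w)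
  have hee : ∀ v, e v * e v = 1 := fun v => by rcases he v with h | h <;> rw [h] <;> norm_num
  have heabs : ∀ v, |e v| = 1 := fun v => by rcases he v with h | h <;> rw [h] <;> norm_num
  have hle : ∀ (x y : V → ℝ) v,
      (S v).sup' (hS v) (fun w => e v * (r v w + β * x w)) ≤
      (S v).sup' (hS v) (fun w => e v * (r v w + β * y w)) + β * dist x y := fun x y v => by
    refine Finset.sup'_le _ _ fun w hw => ?_
    have h2 := Finset.le_sup' (fun w => e v * (r v w + β * y w)) hw
    have h3 : e v * (x w - y w) ≤ dist x y := by
      refine (le_abs_self _).trans ?_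
      rw [abs_mul, heabs, one_mul, ← Real.dist_eq]
      exact dist_le_pi_dist x y w
    have h4 := mul_le_mul_of_nonneg_left h3 h0
    have : e v * (r v w + β * x w) = e v * (r v w + β * y w) + β * (e v * (x w - y w)) := by ring
    linarith
  have hT : ContractingWith β.toNNReal T := by
    refine ⟨Real.toNNReal_lt_one.2 h1, LipschitzWith.of_dist_le_mul fun x y => ?_⟩
    refine (dist_pi_le_iff (by positivity)).2 fun v => ?_
    rw [Real.dist_eq, ← mul_sub, abs_mul, heabs, one_mul, abs_sub_le_iff]
    have h2 := hle x y v
    have h3 := hle y x v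
    rw [dist_comm y x] at h3
    rw [Real.coe_toNNReal β h0]
    constructor <;> linarith
  let x := hT.fixedPoint
  have hx : ∀ v, e v * x v = (S v).sup' (hS v) fun w => e v * (r v w + β * x w) := fun v => by
    have h2 : e v * T x v = e v * x v := by rw [congrFun (hT.fixedPoint_isFixedPt) v]
    rw [← h2, ← mul_assoc, hee, one_mul]
  have hs : ∀ v, ∃ w, E v w ∧ x v = r v w + β * x w := fun v => by
    obtain ⟨w, hw, hw'⟩ := Finset.exists_mem_eq_sup' (hS v) fun w => e v * (r v w + β * x w)
    refine ⟨w, (Finset.mem_filter.1 hw).2, ?_⟩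
    rw [← hx] at hw'
    have := congrArg (e v * ·) hw'
    simpa only [← mul_assoc, hee, one_mul] using this
  choose s hs1 hs2 using hs
  refine ⟨s, x, hs1, hs2, fun v w hw => ?_⟩
  rw [hx]
  exact Finset.le_sup' (fun w => e v * (r v w + β * x w)) (by simp [S, hw])

include hE in
/-- Mean-payoff games have gains `a` and biases `b` that satisfy the optimality equations. -/
theorem exists_gain_bias (he : ∀ v, e v = 1 ∨ e v = -1) :
    ∃ (s : V → V) (a b : V → ℝ), (∀ v, E v (s v)) ∧
      (∀ v, a (s v) = a v ∧ b v = r v (s v) - a v + b (s v)) ∧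
      ∀ v w, E v w → e v * a w ≤ e v * a v ∧
        (a w = a v → e v * (r v w - a v + b w) ≤ e v * b v) := by
  cases nonempty_fintype V
  let t : ℕ → ℝ := fun k => 1 / ((k : ℝ) + 1)
  have ht0 : ∀ k, 0 < t k := fun k => by positivity
  have ht1 : ∀ k, t k ≤ 1 := fun k => by
    simp only [t]
    rw [div_le_one (by positivity)]
    linarith [(Nat.cast_nonneg k : (0 : ℝ) ≤ k)]
  have htt : Tendsto t atTop (𝓝 0) := tendsto_one_div_add_atTop_nhds_zero_nat
  choose s x hs hx hopt using fun k => exists_discounted_value E hE r e he (β := 1 - t k)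
    (by linarith [ht1 k]) (by linarith [ht0 k])
  -- There are finitely many positional strategies, so a single one is optimal for infinitely many
  -- of the discount factors tending to 1.
  obtain ⟨f, hf⟩ : ∃ f, ∃ᶠ k in atTop, s k = f := by
    obtain ⟨f, hf⟩ := Finite.exists_infinite_fiber s
    refine ⟨f, Nat.frequently_atTop_iff_infinite.2 ?_⟩
    exact Set.infinite_coe_iff.1 hf
  obtain ⟨φ, hφ, hsφ⟩ := extraction_of_frequently_atTop hf
  obtain ⟨a, b0, ha, hb0⟩ := exists_invariant_add_coboundary f fun v => r v (f v)
  -- The discounted value is a / t + D: `a`, the invariant part of the reward under `f`, carries the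
  -- pole at t = 0, and the remainder `D` stays bounded. The bias is a limit point of `D`.
  let D : ℕ → V → ℝ := fun k v => x (φ k) v - a v / t (φ k)
  have hD : ∀ k v, x (φ k) v = a v / t (φ k) + D k v := fun k v => by simp [D]
  -- The fixed-point equation under `f` bounds the norm of `D k - b0` by (1 - t) times itself plus t
  -- ‖b0‖, and t cancels.
  have hbd : ∀ k, ‖D k - b0‖ ≤ ‖b0‖ := fun k => by
    have hstep : ∀ v, (D k - b0) v = (1 - t (φ k)) * (D k - b0) (f v) - t (φ k) * b0 (f v) :=
      fun v => by
        have h1 := hx (φ k) v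
        rw [hsφ] at h1
        have h2 := hb0 v
        have h3 : a v / t (φ k) * t (φ k) = a v := div_mul_cancel₀ _ (ht0 _).ne'
        simp only [Pi.sub_apply, D, ha]
        rw [h1]
        linear_combination h2 - h3
    have h4 : ‖D k - b0‖ ≤ (1 - t (φ k)) * ‖D k - b0‖ + t (φ k) * ‖b0‖ := by
      refine (pi_norm_le_iff_of_nonneg ?_).2 fun v => ?_
      · have := mul_nonneg (sub_nonneg.2 (ht1 (φ k))) (norm_nonneg (D k - b0))
        have := mul_nonneg (ht0 (φ k)).le (norm_nonneg b0)
        linarith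
      · rw [hstep]
        refine (norm_sub_le _ _).trans ?_
        rw [norm_mul, norm_mul, Real.norm_of_nonneg (sub_nonneg.2 (ht1 (φ k))),
          Real.norm_of_nonneg (ht0 (φ k)).le]
        exact add_le_add
          (mul_le_mul_of_nonneg_left (norm_le_pi_norm _ _) (sub_nonneg.2 (ht1 _)))
          (mul_le_mul_of_nonneg_left (norm_le_pi_norm _ _) (ht0 _).le)
    have h5 : t (φ k) * ‖D k - b0‖ ≤ t (φ k) * ‖b0‖ := by linarith
    exact le_of_mul_le_mul_left h5 (ht0 _)
  obtain ⟨b, -, ψ, hψ, hlim⟩ := tendsto_subseq_of_bounded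
    (Metric.isBounded_closedBall (x := b0) (r := ‖b0‖))
    (fun k => mem_closedBall_iff_norm.2 (hbd k))
  have hlim' : ∀ v, Tendsto (fun k => D (ψ k) v) atTop (𝓝 (b v)) :=
    fun v => (tendsto_pi_nhds.1 hlim) v
  have htl : Tendsto (fun k => t (φ (ψ k))) atTop (𝓝 0) :=
    htt.comp (hφ.tendsto_atTop.comp hψ.tendsto_atTop)
  have h1t : Tendsto (fun k => 1 - t (φ (ψ k))) atTop (𝓝 1) := by
    simpa using tendsto_const_nhds.sub htl
  refine ⟨f, a, b, fun v => hsφ 0 ▸ hs _ v, fun v => ⟨ha v, ?_⟩, fun v w hw => ⟨?_, fun haw => ?_⟩⟩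
  · have h1 : ∀ k, D (ψ k) v = r v (f v) - a v + (1 - t (φ (ψ k))) * D (ψ k) (f v) := fun k => by
      have h1 := hx (φ (ψ k)) v
      rw [hsφ, hD, hD, ha] at h1
      have h3 : a v / t (φ (ψ k)) * t (φ (ψ k)) = a v := div_mul_cancel₀ _ (ht0 _).ne'
      linear_combination h1 - h3
    have h2 : Tendsto (fun k => r v (f v) - a v + (1 - t (φ (ψ k))) * D (ψ k) (f v)) atTop
        (𝓝 (r v (f v) - a v + 1 * b (f v))) := tendsto_const_nhds.add (h1t.mul (hlim' _))
    rw [one_mul] at h2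
    exact tendsto_nhds_unique (hlim' v) (h2.congr fun k => (h1 k).symm)
  -- Multiplying the discounted optimality inequality by t leaves the comparison of gains in the
  -- limit.
  · have h1 : ∀ k, e v * (t (φ (ψ k)) * r v w +
        (1 - t (φ (ψ k))) * (a w + t (φ (ψ k)) * D (ψ k) w)) ≤
        e v * (a v + t (φ (ψ k)) * D (ψ k) v) := fun k => by
      have h1 := mul_le_mul_of_nonneg_left (hopt (φ (ψ k)) v w hw) (ht0 (φ (ψ k))).le
      rw [hD, hD] at h1
      have h3 : a v / t (φ (ψ k)) * t (φ (ψ k)) = a v := div_mul_cancel₀ _ (ht0 _).ne'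
      have h4 : a w / t (φ (ψ k)) * t (φ (ψ k)) = a w := div_mul_cancel₀ _ (ht0 _).ne'
      calc _ = _ := ?_
        _ ≤ _ := h1
        _ = _ := ?_
      · linear_combination (-e v * (1 - t (φ (ψ k)))) * h4
      · linear_combination e v * h3
    have h2 : Tendsto (fun k => e v * (t (φ (ψ k)) * r v w +
        (1 - t (φ (ψ k))) * (a w + t (φ (ψ k)) * D (ψ k) w))) atTop
        (𝓝 (e v * (0 * r v w + 1 * (a w + 0 * b w)))) :=
      tendsto_const_nhds.mul ((htl.mul tendsto_const_nhds).add
        (h1t.mul (tendsto_const_nhds.add (htl.mul (hlim' w)))))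
    have h3 : Tendsto (fun k => e v * (a v + t (φ (ψ k)) * D (ψ k) v)) atTop
        (𝓝 (e v * (a v + 0 * b v))) :=
      tendsto_const_nhds.mul (tendsto_const_nhds.add (htl.mul (hlim' v)))
    simpa using le_of_tendsto_of_tendsto' h2 h3 h1
  -- With equal gains the poles cancel, and the next order of the same inequality compares the
  -- biases.
  · have h1 : ∀ k, e v * (r v w - a v + (1 - t (φ (ψ k))) * D (ψ k) w) ≤ e v * D (ψ k) v :=
      fun k => by
        have h1 := hopt (φ (ψ k)) v w hw
        rw [hD, hD, haw] at h1
        have h3 : a v / t (φ (ψ k)) * t (φ (ψ k)) = a v := div_mul_cancel₀ _ (ht0 _).ne'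
        linear_combination h1 + e v * h3
    have h2 : Tendsto (fun k => e v * (r v w - a v + (1 - t (φ (ψ k))) * D (ψ k) w)) atTop
        (𝓝 (e v * (r v w - a v + 1 * b w))) :=
      tendsto_const_nhds.mul (tendsto_const_nhds.add (h1t.mul (hlim' w)))
    rw [one_mul] at h2
    exact le_of_tendsto_of_tendsto' h2 (tendsto_const_nhds.mul (hlim' v)) h1

/-- Along a path whose gains never decrease, and whose steps with constant gain satisfy the bias
inequality, the limit average is at least the initial gain. -/
theorem gain_le_limAvg {ρ : ℕ → V} {a b : V → ℝ} {g : ℕ → ℝ}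
    (h1 : ∀ i, a (ρ i) ≤ a (ρ (i + 1)))
    (h2 : ∀ i, a (ρ (i + 1)) = a (ρ i) → b (ρ i) ≤ g i - a (ρ i) + b (ρ (i + 1))) :
    (a (ρ 0) : EReal) ≤ limAvg g := by
  cases nonempty_fintype V
  have hmono : Monotone fun i => a (ρ i) := monotone_nat_of_le_succ h1
  -- Gains take finitely many values and never decrease, so they are constant from a visit to a
  -- maximal one on. From there the bias inequality telescopes.
  obtain ⟨N, hN⟩ : ∃ N, ∀ i, N ≤ i → a (ρ i) = a (ρ N) := by
    obtain ⟨N, hN⟩ := Finite.exists_max (fun u : Set.range ρ => a u)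
    obtain ⟨_, N, rfl⟩ := N
    exact ⟨N, fun i hi => le_antisymm (hN ⟨ρ i, i, rfl⟩) (hmono hi)⟩
  have hsum : ∀ n, n * a (ρ N) + b (ρ N) - b (ρ (N + n)) ≤ ∑ i ∈ Finset.range n, g (N + i) := by
    intro n
    induction n with
    | zero => simp
    | succ n ih =>
      rw [Finset.sum_range_succ]
      have h3 := h2 (N + n) (by rw [hN (N + n) (by omega), hN (N + n + 1) (by omega)])
      rw [hN (N + n) (by omega)] at h3
      push_cast
      rw [← add_assoc]
      linarith
  refine le_trans (EReal.coe_le_coe_iff.2 (hmono (Nat.zero_le N))) ?_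
  obtain ⟨c, hc⟩ : ∃ c, ∀ v, |b v| ≤ c := ⟨‖b‖, fun v => norm_le_pi_norm b v⟩
  refine coe_le_limAvg (2 * c + ∑ i ∈ Finset.range N, |g i - a (ρ N)|) fun n => ?_
  rcases le_total N n with hn | hn
  · obtain ⟨m, rfl⟩ := Nat.exists_eq_add_of_le hn
    rw [Finset.sum_range_add]
    have h4 := hsum m
    have h5 : - ∑ i ∈ Finset.range N, |g i - a (ρ N)| ≤ ∑ i ∈ Finset.range N, (g i - a (ρ N)) := by
      rw [← Finset.sum_neg_distrib]
      exact Finset.sum_le_sum fun i _ => neg_abs_le _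
    simp only [Finset.sum_sub_distrib (f := g), Finset.sum_const, Finset.card_range,
      nsmul_eq_mul] at h5
    have h6 := abs_le.1 (hc (ρ N))
    have h7 := abs_le.1 (hc (ρ (N + m)))
    push_cast
    linarith
  · have h5 : - ∑ i ∈ Finset.range N, |g i - a (ρ N)| ≤ ∑ i ∈ Finset.range n, (g i - a (ρ N)) := by
      refine le_trans (neg_le_neg (Finset.sum_le_sum_of_subset_of_nonneg
        (Finset.range_mono hn) fun _ _ _ => abs_nonneg _)) ?_
      rw [← Finset.sum_neg_distrib]
      exact Finset.sum_le_sum fun i _ => neg_abs_le _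
    simp only [Finset.sum_sub_distrib (f := g), Finset.sum_const, Finset.card_range,
      nsmul_eq_mul] at h5
    have h6 := (abs_nonneg _).trans (hc (ρ 0))
    linarith

end Determinacy

namespace Arena

variable {P V : Type*} (G : Arena P V)

/-- Positional determinacy: every player has, with the coalition of the others, a pair of optimal
positional strategies. -/
theorem exists_isOptimalPositional [Finite V] (q : P) : ∃ s, G.IsOptimalPositional q s := by
  classical
  obtain ⟨s, a, b, hs, heq, hle⟩ := exists_gain_bias G.Edge G.exists_edge
    (fun v w => (G.reward q v w : ℝ)) (fun v => if G.owner v = q then 1 else -1)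
    (fun v => by by_cases h : G.owner v = q <;> simp [h])
  refine ⟨s, hs, a, fun π hπ => ⟨fun h => ?_, fun h => ?_⟩⟩
  · have key : ∀ i, a (π i) ≤ a (π (i + 1)) ∧ (a (π (i + 1)) = a (π i) →
        b (π i) ≤ G.reward q (π i) (π (i + 1)) - a (π i) + b (π (i + 1))) := fun i => by
      by_cases ho : G.owner (π i) = q
      · rw [h i ho]
        exact ⟨(heq _).1.ge, fun _ => (heq _).2.le⟩
      · have := hle _ _ (hπ i)
        simp only [if_neg ho] at this
        exact ⟨by linarith [this.1], fun h' => by linarith [this.2 h']⟩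
    exact gain_le_limAvg (fun i => (key i).1) fun i => (key i).2
  · have key : ∀ i, -a (π i) ≤ -a (π (i + 1)) ∧ (-a (π (i + 1)) = -a (π i) →
        -b (π i) ≤ -G.reward q (π i) (π (i + 1)) - -a (π i) + -b (π (i + 1))) := fun i => by
      by_cases ho : G.owner (π i) = q
      · have := hle _ _ (hπ i)
        simp only [if_pos ho] at this
        exact ⟨by linarith [this.1], fun h' => by linarith [this.2 (neg_injective h')]⟩
      · rw [h i ho, (heq _).1]
        exact ⟨le_rfl, fun _ => by linarith [(heq (π i)).2]⟩
    exact gain_le_limAvg (a := fun v => -a v) (b := fun v => -b v)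
      (fun i => (key i).1) fun i => (key i).2

end Arena

/-! ### Edge frequencies of paths and closed walks -/

open Classical in
/-- Indicator vector of the edge `(u, w)`. -/
noncomputable def edgeInd {V : Type*} (u w : V) : V × V → ℝ :=
  fun e => if u = e.1 ∧ w = e.2 then 1 else 0

/-- Frequencies of the edges on the first `n` steps of `π`. -/
noncomputable def edgeFreq {V : Type*} (π : ℕ → V) (n : ℕ) : V × V → ℝ :=
  (n : ℝ)⁻¹ • ∑ i ∈ Finset.range n, edgeInd (π i) (π (i + 1))

/-- Edge frequencies of the nonempty closed walks from `v` inside `W`. -/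
def closedWalkFreq {V : Type*} (E : V → V → Prop) (W : Set V) (v : V) : Set (V × V → ℝ) :=
  {x | ∃ (B : ℕ → V) (L : ℕ), 0 < L ∧ B 0 = v ∧ B L = v ∧ (∀ i < L, E (B i) (B (i + 1))) ∧
    (∀ i < L, B i ∈ W) ∧ x = edgeFreq B L}

theorem tendsto_edgeFreq_of_tail {V : Type*} {π : ℕ → V} {x : V × V → ℝ} (n : ℕ)
    (h : Tendsto (edgeFreq fun i => π (i + n)) atTop (𝓝 x)) :
    Tendsto (edgeFreq π) atTop (𝓝 x) := by
  rw [← tendsto_add_atTop_iff_nat n]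
  let c := ∑ i ∈ Finset.range n, edgeInd (π i) (π (i + 1))
  have h0 : Tendsto (fun t : ℕ => ((t + n : ℕ) : ℝ)⁻¹) atTop (𝓝 0) :=
    (tendsto_add_atTop_iff_nat n).2 tendsto_inv_atTop_nhds_zero_nat
  have h1 : Tendsto (fun t : ℕ => ((t + n : ℕ) : ℝ)⁻¹ • (c - (n : ℝ) • x)) atTop (𝓝 0) := by
    simpa using h0.smul_const (c - (n : ℝ) • x)
  have h2 : Tendsto (fun t : ℕ => (1 - ((t + n : ℕ) : ℝ)⁻¹ * n) •
      (edgeFreq (fun i => π (i + n)) t - x)) atTop (𝓝 ((1 - 0 * (n : ℝ)) • (x - x))) :=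
    (tendsto_const_nhds.sub (h0.mul_const _)).smul (h.sub_const x)
  have h3 := (h1.add h2).add_const x
  simp only [sub_self, smul_zero, add_zero, zero_add] at h3
  refine h3.congr' ?_
  filter_upwards [eventually_gt_atTop 0] with t ht
  have ht' : (t : ℝ) ≠ 0 := by exact_mod_cast ht.ne'
  have htn : ((t : ℝ) + n) ≠ 0 := by positivity
  have h4 : ∑ i ∈ Finset.range (t + n), edgeInd (π i) (π (i + 1)) =
      c + (t : ℝ) • edgeFreq (fun i => π (i + n)) t := by
    rw [edgeFreq, smul_inv_smul₀ ht', add_comm t n, Finset.sum_range_add]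
    congr 1
    refine Finset.sum_congr rfl fun i _ => ?_
    rw [add_comm n i, add_right_comm i n 1]
  have h5 : edgeFreq π (t + n) = ((t + n : ℕ) : ℝ)⁻¹ •
      (c + (t : ℝ) • edgeFreq (fun i => π (i + n)) t) := by rw [← h4, edgeFreq]
  funext e
  rw [h5]
  simp only [Pi.add_apply, Pi.smul_apply, Pi.sub_apply, smul_eq_mul]
  push_cast
  field_simp
  ring

section Frequencies

variable {V : Type*} [Fintype V]

theorem norm_edgeInd_le (u w : V) : ‖edgeInd u w‖ ≤ 1 := by
  refine (pi_norm_le_iff_of_nonneg zero_le_one).2 fun e => ?_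
  unfold edgeInd
  split_ifs <;> simp

theorem norm_edgeFreq_le (π : ℕ → V) (n : ℕ) : ‖edgeFreq π n‖ ≤ 1 := by
  have h : ‖∑ i ∈ Finset.range n, edgeInd (π i) (π (i + 1))‖ ≤ n := by
    refine (norm_sum_le _ _).trans ?_
    refine (Finset.sum_le_card_nsmul _ _ 1 fun i _ => norm_edgeInd_le _ _).trans (by simp)
  rw [edgeFreq, norm_smul, norm_inv, Real.norm_natCast]
  rcases Nat.eq_zero_or_pos n with rfl | hn
  · simp
  · rw [inv_mul_le_iff₀ (by exact_mod_cast hn), mul_one]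
    exact h

theorem dotProduct_edgeInd (r : V × V → ℝ) (u w : V) : r ⬝ᵥ edgeInd u w = r (u, w) := by
  classical
  rw [dotProduct, Finset.sum_eq_single (u, w)]
  · simp [edgeInd]
  · rintro ⟨u', w'⟩ - hne
    rw [edgeInd, if_neg, mul_zero]
    rintro ⟨rfl, rfl⟩
    exact hne rfl
  · simp

theorem dotProduct_edgeFreq (r : V × V → ℝ) (π : ℕ → V) (n : ℕ) :
    r ⬝ᵥ edgeFreq π n = (∑ i ∈ Finset.range n, r (π i, π (i + 1))) / n := by
  rw [edgeFreq, dotProduct_smul, dotProduct_sum, smul_eq_mul, inv_mul_eq_div]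
  simp only [dotProduct_edgeInd]

theorem continuous_dotProduct_left (r : V × V → ℝ) : Continuous fun x => r ⬝ᵥ x := by
  unfold dotProduct
  fun_prop

theorem limAvg_eq_dotProduct {r : V × V → ℝ} {π : ℕ → V} {x : V × V → ℝ}
    (h : Tendsto (edgeFreq π) atTop (𝓝 x)) :
    limAvg (fun i => r (π i, π (i + 1))) = ((r ⬝ᵥ x : ℝ) : EReal) := by
  refine limAvg_eq_of_tendsto ?_
  refine (((continuous_dotProduct_left r).tendsto x).comp h).congr fun n => ?_
  exact dotProduct_edgeFreq r π n

/-- Every limit of edge frequencies of closed walks at `v` is the limit edge frequency of a path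
from `v`. -/
theorem exists_path_of_mem_closure {E : V → V → Prop} {W : Set V} {v : V} {x : V × V → ℝ}
    (hx : x ∈ closure (closedWalkFreq E W v)) :
    ∃ ρ : ℕ → V, ρ 0 = v ∧ (∀ i, E (ρ i) (ρ (i + 1))) ∧ (∀ i, ρ i ∈ W) ∧
      Tendsto (edgeFreq ρ) atTop (𝓝 x) := by
  obtain ⟨y, hy, hyx⟩ := mem_closure_iff_seq_limit.1 hx
  choose B L hL hB0 hBL hBE hBW hyB using hy
  -- Round `j` runs the closed walk number `k j`, the largest index up to `j` whose squared length
  -- is at most `j`. Thus `k j` tends to infinity, yet from round `L 0 ^ 2` on the walk has length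
  -- at most √j, so an unfinished round is negligible.
  let k : ℕ → ℕ := fun j => Nat.findGreatest (fun k => L k ^ 2 ≤ j) j
  have hk : Tendsto k atTop atTop := tendsto_atTop.2 fun m => by
    filter_upwards [eventually_ge_atTop (max m (L m ^ 2))] with j hj
    exact Nat.le_findGreatest (le_of_max_le_left hj) (le_of_max_le_right hj)
  have hkL : ∀ j, L 0 ^ 2 ≤ j → L (k j) ^ 2 ≤ j := fun j hj =>
    Nat.findGreatest_spec (P := fun k => L k ^ 2 ≤ j) (Nat.zero_le j) hj
  -- The state is the pair of the current round and the position inside its walk. All walks start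
  -- and end at `v`, so consecutive rounds fit together.
  let next : ℕ × ℕ → ℕ × ℕ := fun s => if s.2 + 1 < L (k s.1) then (s.1, s.2 + 1) else (s.1 + 1, 0)
  let st : ℕ → ℕ × ℕ := fun t => next^[t] (0, 0)
  have hst : ∀ t, st (t + 1) = next (st t) := fun t => Function.iterate_succ_apply' _ _ _
  have hlt : ∀ t, (st t).2 < L (k (st t).1) := fun t => by
    induction t with
    | zero => exact hL _
    | succ t ih =>
      rw [hst]
      simp only [next]
      split_ifs with h
      · exact h
      · exact hL _
  let ρ : ℕ → V := fun t => B (k (st t).1) (st t).2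
  have hρ : ∀ t, ρ (t + 1) = B (k (st t).1) ((st t).2 + 1) := fun t => by
    simp only [ρ, hst, next]
    split_ifs with h
    · rfl
    · have : (st t).2 + 1 = L (k (st t).1) := le_antisymm (hlt t) (not_lt.1 h)
      rw [this, hBL, hB0]
  refine ⟨ρ, hB0 _, fun t => ?_, fun t => hBW _ _ (hlt t), ?_⟩
  · rw [hρ]
    exact hBE _ _ (hlt t)
  have hmono : Monotone fun t => (st t).1 := monotone_nat_of_le_succ fun t => by
    rw [hst]
    simp only [next]
    split_ifs <;> simp
  have hjle : ∀ t, (st t).1 ≤ t := fun t => by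
    induction t with
    | zero => exact le_rfl
    | succ t ih =>
      rw [hst]
      simp only [next]
      split_ifs <;> simp <;> omega
  have hjtop : Tendsto (fun t => (st t).1) atTop atTop := by
    refine tendsto_atTop_atTop_of_monotone hmono fun b => ?_
    induction b with
    | zero => exact ⟨0, Nat.zero_le _⟩
    | succ b ih =>
      obtain ⟨a, ha⟩ := ih
      by_contra! hcon
      have hconst : ∀ m, (st (a + m)).1 = b := fun m =>
        le_antisymm (Nat.lt_succ_iff.1 (hcon _)) (ha.trans (hmono (Nat.le_add_right a m)))
      have hi : ∀ m, m ≤ (st (a + m)).2 := fun m => by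
        induction m with
        | zero => exact Nat.zero_le _
        | succ m ih =>
          have h1 := hconst (m + 1)
          rw [← add_assoc, hst] at h1 ⊢
          simp only [next] at h1 ⊢
          split_ifs at h1 ⊢ with h
          · simpa using ih
          · rw [hconst m] at h1
            simp at h1
      have h1 := hi (L (k b))
      have h2 := hlt (a + L (k b))
      rw [hconst] at h2
      omega
  let ε : ℕ → ℝ := fun t => ‖y (k (st t).1) - x‖
  have hε : Tendsto ε atTop (𝓝 0) := by
    have h1 : Tendsto (fun m => ‖y m - x‖) atTop (𝓝 0) := tendsto_iff_norm_sub_tendsto_zero.1 hyx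
    exact h1.comp (hk.comp hjtop)
  let ψ : ℕ → ℕ → V × V → ℝ := fun m i => edgeInd (B m i) (B m (i + 1)) - x
  have hblock : ∀ m, ∑ i ∈ Finset.range (L m), ψ m i = (L m : ℝ) • (y m - x) := fun m => by
    have : (L m : ℝ) ≠ 0 := by exact_mod_cast (hL m).ne'
    rw [hyB, edgeFreq, smul_sub, smul_inv_smul₀ this]
    simp [ψ, Finset.sum_sub_distrib, ← Nat.cast_smul_eq_nsmul ℝ]
  let S : ℕ → V × V → ℝ := fun t => ∑ s ∈ Finset.range t, (edgeInd (ρ s) (ρ (s + 1)) - x)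
  have hS : ∀ t, S (t + 1) = S t + ψ (k (st t).1) (st t).2 := fun t => by
    simp only [S, Finset.sum_range_succ, ψ, hρ t]
    rfl
  -- A finished round contributes L(y - x), of norm L times `ε`. Subtracting the unfinished round
  -- leaves the finished ones; the term `(st t).2 * ε t` keeps in reserve the errors of the steps
  -- already made in the current round.
  have hinv : ∀ t, ‖S t - ∑ i ∈ Finset.range (st t).2, ψ (k (st t).1) i‖ + (st t).2 * ε t ≤
      ∑ s ∈ Finset.range t, ε s := fun t => by
    induction t with
    | zero => simp [S, st]
    | succ t ih =>
      rw [Finset.sum_range_succ, hS]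
      by_cases h : (st t).2 + 1 < L (k (st t).1)
      · have h1 : st (t + 1) = ((st t).1, (st t).2 + 1) := by
          rw [hst]
          simp only [next, if_pos h]
        have h2 : ε (t + 1) = ε t := by simp only [ε, h1]
        rw [h2, h1]
        simp only
        rw [Finset.sum_range_succ, add_sub_add_right_eq_sub]
        push_cast
        linarith
      · have h1 : st (t + 1) = ((st t).1 + 1, 0) := by
          rw [hst]
          simp only [next, if_neg h]
        have h3 : (st t).2 + 1 = L (k (st t).1) := le_antisymm (hlt t) (not_lt.1 h)
        have h4 := hblock (k (st t).1)
        rw [← h3, Finset.sum_range_succ] at h4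
        rw [h1]
        simp only [Finset.range_zero, Finset.sum_empty, sub_zero, Nat.cast_zero, zero_mul, add_zero]
        have h5 : S t + ψ (k (st t).1) (st t).2 =
            (S t - ∑ i ∈ Finset.range (st t).2, ψ (k (st t).1) i) +
            (((st t).2 + 1 : ℕ) : ℝ) • (y (k (st t).1) - x) := by
          rw [← h4]
          abel
        rw [h5]
        refine (norm_add_le _ _).trans ?_
        rw [norm_smul, Real.norm_natCast]
        push_cast
        simp only [ε] at ih ⊢
        linarith
  have hψ : ∀ m i, ‖ψ m i‖ ≤ 1 + ‖x‖ := fun m i =>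
    (norm_sub_le _ _).trans (by linarith [norm_edgeInd_le (B m i) (B m (i + 1))])
  have hbound : ∀ t, ‖S t‖ ≤ ∑ s ∈ Finset.range t, ε s + (st t).2 * (1 + ‖x‖) := fun t => by
    have h1 : ‖∑ i ∈ Finset.range (st t).2, ψ (k (st t).1) i‖ ≤ (st t).2 * (1 + ‖x‖) := by
      refine (norm_sum_le _ _).trans ?_
      refine (Finset.sum_le_card_nsmul _ _ _ fun i _ => hψ _ i).trans_eq ?_
      rw [Finset.card_range, nsmul_eq_mul]
    have h2 := hinv t
    have h3 := norm_add_le (S t - ∑ i ∈ Finset.range (st t).2, ψ (k (st t).1) i)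
      (∑ i ∈ Finset.range (st t).2, ψ (k (st t).1) i)
    rw [sub_add_cancel] at h3
    have h4 : 0 ≤ (st t).2 * ε t := by positivity
    linarith
  have hces : Tendsto (fun t : ℕ => (t : ℝ)⁻¹ * ∑ s ∈ Finset.range t, ε s) atTop (𝓝 0) := hε.cesaro
  have hsq : Tendsto (fun t : ℕ => (√(t : ℝ))⁻¹ * (1 + ‖x‖)) atTop (𝓝 0) := by
    have := (Real.tendsto_sqrt_atTop.comp tendsto_natCast_atTop_atTop).inv_tendsto_atTop.mul_const
      (1 + ‖x‖)
    simpa using this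
  have hfin : Tendsto (fun t : ℕ => (t : ℝ)⁻¹ • S t) atTop (𝓝 0) := by
    have h0 := hces.add hsq
    rw [add_zero] at h0
    refine squeeze_zero_norm' ?_ h0
    filter_upwards [eventually_gt_atTop 0, hjtop.eventually_ge_atTop (L 0 ^ 2)] with t ht hj
    have ht' : (0 : ℝ) < t := by exact_mod_cast ht
    rw [norm_smul, norm_inv, Real.norm_natCast]
    have h1 : ((st t).2 : ℝ) ≤ √t := by
      refine Real.le_sqrt_of_sq_le ?_
      have := (Nat.pow_le_pow_left (hlt t).le 2).trans ((hkL _ hj).trans (hjle t))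
      exact_mod_cast this
    calc (t : ℝ)⁻¹ * ‖S t‖
        ≤ (t : ℝ)⁻¹ * (∑ s ∈ Finset.range t, ε s + √t * (1 + ‖x‖)) := by
          refine mul_le_mul_of_nonneg_left ((hbound t).trans ?_) (inv_nonneg.2 ht'.le)
          gcongr
      _ = _ := by
          rw [mul_add, ← mul_assoc, inv_mul_eq_div _ √(t : ℝ), Real.sqrt_div_self]
  have h0 := hfin.add_const x
  rw [zero_add] at h0
  refine h0.congr' ?_
  filter_upwards [eventually_gt_atTop 0] with t ht
  have ht' : (t : ℝ) ≠ 0 := by exact_mod_cast ht.ne'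
  simp only [S, Finset.sum_sub_distrib, smul_sub, edgeFreq, Finset.sum_const, Finset.card_range,
    ← Nat.cast_smul_eq_nsmul ℝ, inv_smul_smul₀ ht', sub_add_cancel]

/-- Every path visits some vertex `v` such that some limit of edge frequencies of closed walks at
`v`, inside the set of visited vertices, is at least as good as the path for every reward. -/
theorem exists_mem_closure_of_path {E : V → V → Prop} {π : ℕ → V}
    (hπ : ∀ i, E (π i) (π (i + 1))) :
    ∃ n, ∃ x ∈ closure (closedWalkFreq E (Set.range π) (π n)), ∀ (r : V × V → ℝ) (c : ℝ),
      (c : EReal) ≤ limAvg (fun i => r (π i, π (i + 1))) → c ≤ r ⬝ᵥ x := by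
  -- The segments from the first chosen visit of `v` to the later ones are closed walks. The
  -- averages along them form a subsequence of the averages of the shifted path, so their limit is
  -- at least the liminf, whatever the reward.
  obtain ⟨v, hv⟩ := Finite.exists_infinite_fiber π
  have hv' : ∃ᶠ k in atTop, π k = v :=
    Nat.frequently_atTop_iff_infinite.2 (Set.infinite_coe_iff.1 hv)
  obtain ⟨φ, hφ, hπφ⟩ := extraction_of_frequently_atTop hv'
  let l : ℕ → ℕ := fun m => φ (m + 1) - φ 0
  have hl : StrictMono l := strictMono_nat_of_lt_succ fun m => by
    have h1 := hφ (Nat.succ_pos m)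
    have h2 := hφ (Nat.lt_succ_self (m + 1))
    simp only [l, Nat.succ_eq_add_one] at *
    omega
  have hl0 : ∀ m, 0 < l m := fun m => Nat.sub_pos_of_lt (hφ (Nat.succ_pos m))
  have hmem : ∀ m, edgeFreq (fun i => π (i + φ 0)) (l m) ∈
      closedWalkFreq E (Set.range π) (π (φ 0)) := fun m => by
    refine ⟨_, l m, hl0 m, ?_, ?_, fun i _ => ?_, fun i _ => ⟨_, rfl⟩, rfl⟩
    · simp
    · change π (φ (m + 1) - φ 0 + φ 0) = π (φ 0)
      rw [Nat.sub_add_cancel (hφ.monotone (Nat.zero_le _)), hπφ, hπφ]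
    · have := hπ (i + φ 0)
      rwa [add_right_comm] at this
  obtain ⟨x, -, θ, hθ, hlim⟩ := tendsto_subseq_of_bounded
    (Metric.isBounded_closedBall (x := (0 : V × V → ℝ)) (r := 1))
    (fun m => mem_closedBall_zero_iff.2 (norm_edgeFreq_le (fun i => π (i + φ 0)) (l m)))
  refine ⟨φ 0, x, mem_closure_of_tendsto hlim (Eventually.of_forall fun m => hmem _),
    fun r c hc => ?_⟩
  have hsh := limAvg_shift (a := fun i => r (π i, π (i + 1))) (B := ‖r‖)
    (fun i => norm_le_pi_norm r _) (φ 0)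
  rw [← hsh] at hc
  have hr := ((continuous_dotProduct_left r).tendsto x).comp hlim
  refine le_of_forall_lt fun d hd => ?_
  obtain ⟨d', hd, hd'⟩ := exists_between hd
  refine hd.trans_le (ge_of_tendsto hr ?_)
  have h1 := eventually_lt_of_lt_liminf (lt_of_lt_of_le (EReal.coe_lt_coe_iff.2 hd') hc)
  have h2 := (hl.tendsto_atTop.comp hθ.tendsto_atTop).eventually h1
  filter_upwards [h2] with m hm
  simp only [Function.comp_apply] at hm ⊢
  rw [dotProduct_edgeFreq]
  refine (EReal.coe_lt_coe_iff.1 hm).le.trans (le_of_eq ?_)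
  congr 1
  refine Finset.sum_congr rfl fun i _ => ?_
  rw [add_right_comm]

end Frequencies

/-! ### Existence of a best play for the leader -/

theorem EReal.coe_sum_real {ι : Type*} (s : Finset ι) (f : ι → ℝ) :
    ((∑ i ∈ s, f i : ℝ) : EReal) = ∑ i ∈ s, (f i : EReal) := by
  classical
  induction s using Finset.induction_on with
  | empty => simp
  | insert a s ha ih => rw [Finset.sum_insert ha, Finset.sum_insert ha, EReal.coe_add, ih]

theorem EReal.coe_max_zero_sub_le {m R : ℝ} {I : EReal} (h0 : 0 ≤ I)
    (h : (m : EReal) ≤ (R : EReal) + I) : ((max 0 (m - R) : ℝ) : EReal) ≤ I := by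
  induction I with
  | bot => simp at h0
  | top => exact le_top
  | coe x =>
    norm_cast at h h0 ⊢
    exact max_le h0 (by linarith)

/-- For every family of continuous objectives, which depend on the set of visited vertices, some
path with limit edge frequencies is at least as good as, for each other path, some vector that
dominates the limit averages of this path for every reward. -/
theorem exists_optimal_path {V : Type*} [Fintype V] {E : V → V → Prop} (hE : ∀ v, ∃ w, E v w)
    (v₀ : V) {f : Set V → (V × V → ℝ) → ℝ} (hf : ∀ W, Continuous (f W)) :
    ∃ (W : Set V) (x : V × V → ℝ) (π : ℕ → V), π 0 = v₀ ∧ (∀ i, E (π i) (π (i + 1))) ∧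
      (∀ i, π i ∈ W) ∧ Tendsto (edgeFreq π) atTop (𝓝 x) ∧
      ∀ ρ : ℕ → V, ρ 0 = v₀ → (∀ i, E (ρ i) (ρ (i + 1))) → ∃ y,
        (∀ (r : V × V → ℝ) (c : ℝ),
          (c : EReal) ≤ limAvg (fun i => r (ρ i, ρ (i + 1))) → c ≤ r ⬝ᵥ y) ∧
        f (Set.range ρ) y ≤ f W x := by
  -- Finitely many pairs of a vertex set and a base vertex that is reachable inside the set and
  -- carries a closed walk there. A competing path is filed under its exact set of visited vertices.
  let A : Set (Set V × V) := {a | (closedWalkFreq E a.1 a.2).Nonempty ∧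
    ∃ (h : ℕ → V) (n : ℕ), h 0 = v₀ ∧ h n = a.2 ∧ (∀ i < n, E (h i) (h (i + 1))) ∧
      ∀ i < n, h i ∈ a.1}
  have hpath : ∀ ρ : ℕ → V, ρ 0 = v₀ → (∀ i, E (ρ i) (ρ (i + 1))) → ∃ v, (Set.range ρ, v) ∈ A ∧
      ∃ x ∈ closure (closedWalkFreq E (Set.range ρ) v), ∀ (r : V × V → ℝ) (c : ℝ),
      (c : EReal) ≤ limAvg (fun i => r (ρ i, ρ (i + 1))) → c ≤ r ⬝ᵥ x := fun ρ h0 hρ => by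
    obtain ⟨n, x, hx, hr⟩ := exists_mem_closure_of_path hρ
    exact ⟨ρ n, ⟨closure_nonempty_iff.1 ⟨x, hx⟩, ρ, n, h0, rfl, fun i _ => hρ i,
      fun i _ => ⟨i, rfl⟩⟩, x, hx, hr⟩
  have hA : Nonempty A := by
    choose s hs using hE
    obtain ⟨v, hv, -⟩ := hpath (fun i => s^[i] v₀) rfl fun i => by
      simp only [Function.iterate_succ_apply']
      exact hs _
    exact ⟨_, hv⟩
  have hmax : ∀ a : A, ∃ x ∈ closure (closedWalkFreq E a.1.1 a.1.2),
      ∀ y ∈ closure (closedWalkFreq E a.1.1 a.1.2), f a.1.1 y ≤ f a.1.1 x := fun a => by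
    have hb : Bornology.IsBounded (closedWalkFreq E a.1.1 a.1.2) := by
      refine (Metric.isBounded_closedBall (x := (0 : V × V → ℝ)) (r := 1)).subset ?_
      rintro _ ⟨B, L, -, -, -, -, -, rfl⟩
      exact mem_closedBall_zero_iff.2 (norm_edgeFreq_le _ _)
    obtain ⟨x, hx, hx'⟩ := hb.isCompact_closure.exists_isMaxOn
      (closure_nonempty_iff.2 a.2.1) (hf a.1.1).continuousOn
    exact ⟨x, hx, fun y hy => hx' hy⟩
  obtain ⟨W, v, x, ⟨-, h, n, hh0, hhn, hhE, hhW⟩, hx, hbest⟩ : ∃ W v x, (W, v) ∈ A ∧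
      x ∈ closure (closedWalkFreq E W v) ∧
      ∀ W' v' y, (W', v') ∈ A → y ∈ closure (closedWalkFreq E W' v') → f W' y ≤ f W x := by
    choose X hX hXmax using hmax
    obtain ⟨⟨⟨W, v⟩, ha⟩, hbest⟩ := Finite.exists_max fun a : A => f a.1.1 (X a)
    exact ⟨W, v, X ⟨(W, v), ha⟩, ha, hX ⟨(W, v), ha⟩, fun W' v' y ha' hy =>
      (hXmax ⟨_, ha'⟩ y hy).trans (hbest ⟨_, ha'⟩)⟩
  obtain ⟨ρ, hρ0, hρE, hρW, hρx⟩ := exists_path_of_mem_closure hx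
  simp only at hhn hhW
  -- A finite approach to the base vertex followed by the path with the optimal frequencies. It may
  -- miss part of `W`; only staying inside `W` matters.
  let π : ℕ → V := fun i => if i < n then h i else ρ (i - n)
  have hπn : ∀ i, π (i + n) = ρ i := fun i => by simp [π]
  have hπh : ∀ i, i ≤ n → π i = h i := fun i hi => by
    rcases hi.lt_or_eq with hi | rfl
    · simp [π, hi]
    · rw [hhn, ← hρ0, ← hπn, zero_add]
  have hπE : ∀ i, E (π i) (π (i + 1)) := fun i => by
    rcases lt_or_ge i n with hi | hi
    · rw [hπh i hi.le, hπh (i + 1) hi]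
      exact hhE i hi
    · obtain ⟨j, rfl⟩ := Nat.exists_eq_add_of_le' hi
      rw [add_right_comm, hπn, hπn]
      exact hρE j
  have hπW : ∀ i, π i ∈ W := fun i => by
    rcases lt_or_ge i n with hi | hi
    · rw [hπh i hi.le]
      exact hhW i hi
    · obtain ⟨j, rfl⟩ := Nat.exists_eq_add_of_le' hi
      rw [hπn]
      exact hρW j
  have hπx : Tendsto (edgeFreq π) atTop (𝓝 x) :=
    tendsto_edgeFreq_of_tail n (by simpa only [hπn] using hρx)
  refine ⟨W, x, π, by rw [hπh 0 (Nat.zero_le _), hh0], hπE, hπW, hπx, fun τ hτ0 hτE => ?_⟩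
  obtain ⟨u, hu, y, hy, hry⟩ := hpath τ hτ0 hτE
  exact ⟨y, hry, hbest _ _ y hu hy⟩

namespace Arena

variable {P V : Type*} (G : Arena P V)

theorem exists_abs_reward_le [Finite V] (p : P) : ∃ B : ℝ, ∀ u w, |(G.reward p u w : ℝ)| ≤ B := by
  cases nonempty_fintype V
  exact ⟨‖fun e : V × V => (G.reward p e.1 e.2 : ℝ)‖, fun u w =>
    norm_le_pi_norm (fun e : V × V => (G.reward p e.1 e.2 : ℝ)) (u, w)⟩

theorem exists_rawPayoff_eq_coe [Finite V] (p : P) (π : ℕ → V) :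
    ∃ R : ℝ, G.rawPayoff p π = (R : EReal) := by
  obtain ⟨B, hB⟩ := G.exists_abs_reward_le p
  exact exists_limAvg_eq_coe (B := B) fun i => hB _ _

theorem rawPayoff_shift [Finite V] (p : P) (π : ℕ → V) (k : ℕ) :
    G.rawPayoff p (fun i => π (i + k)) = G.rawPayoff p π := by
  obtain ⟨B, hB⟩ := G.exists_abs_reward_le p
  have := limAvg_shift (a := fun i => (G.reward p (π i) (π (i + 1)) : ℝ)) (B := B)
    (fun i => hB _ _) k
  simpa only [rawPayoff, add_right_comm] using this

open Classical in
/-- Among all plays, with the incentives that raise every follower `p` at least to the maximum of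
`val p` on the visited vertices, some play with limit edge frequencies is best for the leader. -/
theorem exists_optimal_play [Fintype P] [Finite V] (val : P → V → ℝ) :
    ∃ (π : ℕ → V) (R : P → ℝ) (c : P → ℝ≥0), π 0 = G.init ∧ G.IsPath π ∧
      (∀ u w, ∃ x : ℝ, Tendsto (fun n : ℕ =>
        (((Finset.range n).filter fun i => π i = u ∧ π (i + 1) = w).card : ℝ) / n) atTop (𝓝 x)) ∧
      (∀ p, G.rawPayoff p π = (R p : EReal)) ∧ (∀ p i, val p (π i) ≤ R p + c p) ∧
      ∀ ρ : ℕ → V, ρ 0 = G.init → G.IsPath ρ → ∀ I : P → EReal,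
        (∀ p, p ≠ G.leader → 0 ≤ I p ∧ ∀ i, (val p (ρ i) : EReal) ≤ G.rawPayoff p ρ + I p) →
        G.rawPayoff G.leader ρ - ∑ q ∈ Finset.univ.filter (fun q => q ≠ G.leader), I q ≤
          ((R G.leader - ∑ q ∈ Finset.univ.filter (fun q => q ≠ G.leader), (c q : ℝ) : ℝ) :
            EReal) := by
  cases nonempty_fintype V
  let F : Finset P := Finset.univ.filter (fun q => q ≠ G.leader)
  let r : P → V × V → ℝ := fun p e => G.reward p e.1 e.2
  let M : P → Set V → ℝ := fun p W => sSup (val p '' W)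
  -- The leader's payoff when each follower is paid just enough to reach his largest value on `W`.
  let f : Set V → (V × V → ℝ) → ℝ := fun W x =>
    r G.leader ⬝ᵥ x - ∑ q ∈ F, max 0 (M q W - r q ⬝ᵥ x)
  have hf : ∀ W, Continuous (f W) := fun W => by
    have := fun q => continuous_dotProduct_left (r q)
    simp only [f]
    fun_prop
  obtain ⟨W, x, π, hπ0, hπE, hπW, hπx, hbest⟩ := exists_optimal_path G.exists_edge G.init hf
  refine ⟨π, fun p => r p ⬝ᵥ x, fun p => Real.toNNReal (M p W - r p ⬝ᵥ x),
    hπ0, hπE, fun u w => ⟨x (u, w), ?_⟩,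
    fun p => limAvg_eq_dotProduct (r := r p) hπx, fun p i => ?_, fun τ hτ0 hτE I hI => ?_⟩
  · refine (tendsto_pi_nhds.1 hπx (u, w)).congr fun n => ?_
    rw [edgeFreq, Pi.smul_apply, Finset.sum_apply, smul_eq_mul, inv_mul_eq_div]
    congr 1
    simp only [edgeInd, Finset.sum_ite, Finset.sum_const_zero, add_zero, Finset.sum_const,
      nsmul_eq_mul, mul_one]
  · have h1 : val p (π i) ≤ M p W :=
      le_csSup (Set.toFinite _).bddAbove ⟨π i, hπW i, rfl⟩
    have h2 := Real.le_coe_toNNReal (M p W - r p ⬝ᵥ x)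
    linarith
  · obtain ⟨y, hry, h1⟩ := hbest τ hτ0 hτE
    choose R hR using fun p => G.exists_rawPayoff_eq_coe p τ
    have hRy : ∀ p, R p ≤ r p ⬝ᵥ y := fun p => hry (r p) (R p) (hR p).ge
    -- The incentive must close the gap to the largest value on the visited vertices. Since `y` is
    -- at least as good as the play for `q`, the gap computed with `y` is no larger.
    have h2 : ∀ q ∈ F, ((max 0 (M q (Set.range τ) - r q ⬝ᵥ y) : ℝ) : EReal) ≤ I q := fun q hq => by
      obtain ⟨h3, h4⟩ := hI q (Finset.mem_filter.1 hq).2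
      obtain ⟨_, ⟨i, rfl⟩, hi⟩ := (Set.range_nonempty τ).image (val q) |>.csSup_mem (Set.toFinite _)
      have h5 := EReal.coe_max_zero_sub_le h3 (hR q ▸ h4 i)
      refine le_trans ?_ h5
      rw [EReal.coe_le_coe_iff, hi]
      exact max_le_max le_rfl (sub_le_sub_left (hRy q) _)
    have h6 : f W x = r G.leader ⬝ᵥ x -
        ∑ q ∈ F, ((Real.toNNReal (M q W - r q ⬝ᵥ x) : ℝ≥0) : ℝ) := by
      simp only [f, Real.coe_toNNReal', max_comm]
    rw [← h6]
    refine le_trans ?_ (EReal.coe_le_coe_iff.2 h1)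
    simp only [f]
    rw [EReal.coe_sub, EReal.coe_sum_real, hR]
    exact EReal.sub_le_sub (EReal.coe_le_coe_iff.2 (hRy _)) (Finset.sum_le_sum h2)

end Arena

namespace Arena

variable {P V : Type*} (G : Arena P V)

/-! ### Plays of strategy profiles -/

theorem run_eq (σ : G.Profile) (n : ℕ) :
    G.run σ n = ((List.range n).map (G.play σ), G.play σ n) := by
  induction n with
  | zero => rfl
  | succ n ih =>
    have h : (G.run σ (n + 1)).1 = (List.range (n + 1)).map (G.play σ) := by
      rw [List.range_succ, List.map_append, run, ih]
      rfl
    exact Prod.ext h rfl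

theorem play_succ (σ : G.Profile) (n : ℕ) :
    G.play σ (n + 1) = G.next σ ((List.range n).map (G.play σ)) (G.play σ n) := by
  have := G.run_eq σ n
  rw [play, run, this]

theorem edge_next (σ : G.Profile) (past : List V) (v : V) : G.Edge v (G.next σ past v) :=
  (σ (G.owner v)).legal past v rfl

theorem isPath_play (σ : G.Profile) : G.IsPath (G.play σ) := fun i => by
  rw [play_succ]
  exact G.edge_next σ _ _

theorem eq_of_follow {ρ ρ' : ℕ → V} {F : List V → V → V} {n : ℕ} (h0 : ρ 0 = ρ' 0)
    (h : ∀ i < n, ρ (i + 1) = F ((List.range i).map ρ) (ρ i))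
    (h' : ∀ i < n, ρ' (i + 1) = F ((List.range i).map ρ') (ρ' i)) : ∀ i ≤ n, ρ i = ρ' i := by
  intro i
  induction i using Nat.strong_induction_on with
  | _ i ih =>
    intro hi
    cases i with
    | zero => exact h0
    | succ i =>
      rw [h i hi, h' i hi, ih i (Nat.lt_succ_self i) (by omega)]
      congr 1
      refine List.map_congr_left fun j hj => ?_
      have := List.mem_range.1 hj
      exact ih j (by omega) (by omega)

theorem eq_play {σ : G.Profile} {ρ : ℕ → V} (h0 : ρ 0 = G.init)
    (h : ∀ i, ρ (i + 1) = G.next σ ((List.range i).map ρ) (ρ i)) : ρ = G.play σ :=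
  funext fun n => eq_of_follow (F := G.next σ) (n := n) h0 (fun i _ => h i)
    (fun i _ => G.play_succ σ i) n le_rfl

open Classical in
theorem next_deviate_of_ne (σ : G.Profile) {p : P} (τ : G.Strategy p) (past : List V) {v : V}
    (hv : G.owner v ≠ p) : G.next (G.deviate σ p τ) past v = G.next σ past v := by
  rw [next, deviate, Function.update_of_ne hv]
  rfl

theorem next_of_eq (σ : G.Profile) {p : P} (past : List V) {v : V} (hv : G.owner v = p) :
    G.next σ past v = (σ p).move past v := by
  subst hv
  rfl

open Classical in
theorem next_deviate_of_eq (σ : G.Profile) {p : P} (τ : G.Strategy p) (past : List V) {v : V}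
    (hv : G.owner v = p) : G.next (G.deviate σ p τ) past v = τ.move past v := by
  rw [next_of_eq _ _ _ hv, deviate, Function.update_self]

theorem zero_le_incentive (γ : G.Incentives) (p : P) (π : ℕ → V) : 0 ≤ G.incentive γ p π := by
  have := le_limAvg_of_eventually (a := fun i => (γ p ((List.range i).map π) (π i) : ℝ)) (c := 0)
    (N := 0) fun i _ => NNReal.coe_nonneg _
  rwa [EReal.coe_zero] at this

theorem payoff_of_ne [Fintype P] (γ : G.Incentives) {p : P} (hp : p ≠ G.leader) (π : ℕ → V) :
    G.payoff γ p π = G.rawPayoff p π + G.incentive γ p π := if_neg hp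

/-- In an incentive strategy profile, the payoff of each follower is at least what he can enforce
from any vertex of the play by a positional strategy. -/
theorem IsISP.le_payoff [Fintype P] [Finite V] {σ : G.Profile} {γ : G.Incentives}
    (hσ : G.IsISP σ γ) {p : P} (hp : p ≠ G.leader) {s : V → V} (hs : ∀ v, G.Edge v (s v))
    {val : V → ℝ}
    (hval : ∀ π, G.IsPath π → (∀ i, G.owner (π i) = p → π (i + 1) = s (π i)) →
      (val (π 0) : EReal) ≤ G.rawPayoff p π) (n : ℕ) :
    (val (G.play σ n) : EReal) ≤ G.rawPayoff p (G.play σ) + G.incentive γ p (G.play σ) := by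
  -- The deviation keeps to `σ` for `n` moves and then plays `s`. The prefix does not affect the raw
  -- payoff, and incentives are nonnegative.
  let τ : G.Strategy p :=
    { move := fun past v => if past.length < n then (σ p).move past v else s v
      legal := fun past v hv => by
        split_ifs
        · exact (σ p).legal past v hv
        · exact hs v }
  let ρ := G.play (G.deviate σ p τ)
  have hρ : ∀ i, ρ (i + 1) = G.next (G.deviate σ p τ) ((List.range i).map ρ) (ρ i) :=
    G.play_succ _
  have heq : ∀ i ≤ n, ρ i = G.play σ i := by
    refine eq_of_follow (F := G.next σ) rfl (fun i hi => ?_) fun i _ => G.play_succ σ i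
    rw [hρ]
    by_cases ho : G.owner (ρ i) = p
    · rw [next_deviate_of_eq _ _ _ _ ho, next_of_eq _ _ _ ho]
      have : ((List.range i).map ρ).length < n := by simpa using hi
      simp only [τ, if_pos this]
    · rw [next_deviate_of_ne _ _ _ _ ho]
  have h1 : (val (ρ (0 + n)) : EReal) ≤ G.rawPayoff p fun i => ρ (i + n) := by
    refine hval (fun i => ρ (i + n)) (fun i => ?_) fun i ho => ?_
    · have := G.isPath_play (G.deviate σ p τ) (i + n)
      rwa [add_right_comm] at this
    · rw [add_right_comm, hρ, next_deviate_of_eq _ _ _ _ ho]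
      have : ¬ ((List.range (i + n)).map ρ).length < n := by simp
      simp only [τ, if_neg this]
  rw [rawPayoff_shift, zero_add, heq n le_rfl] at h1
  have h2 := hσ p hp τ
  rw [payoff_of_ne _ _ hp, payoff_of_ne _ _ hp] at h2
  refine (h1.trans ?_).trans h2
  exact le_add_of_nonneg_right (G.zero_le_incentive _ _ _)

/-! ### Punishing profiles -/

section Punish

variable (π : ℕ → V) (s : P → V → V)

open Classical in
/-- The move after `n` steps at the vertex `v`: follow `π` as long as nobody has deviated, and the
positional strategies against the last deviator afterwards. -/
noncomputable def punishMove : Option (P × ℕ) → ℕ → V → V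
  -- On a finite play from `π 0` the state `none` forces `v = π n`; the other branch only supplies a
  -- legal move on lists that are not such plays.
  | none, n, v => if v = π n then π (n + 1) else s G.leader v
  | some (q, _), _, v => s q v

open Classical in
/-- The last deviator, and the number of deviations before his, on the history with current vertex
`v` and reversed list of past vertices `l`; `none` if nobody has deviated. -/
noncomputable def revDevState : List V → V → Option (P × ℕ)
  | [], _ => none
  | u :: l, v =>
    if v = G.punishMove π s (revDevState l u) l.length u then revDevState l u
    else some (G.owner u, (revDevState l u).elim 0 fun x => x.2 + 1)

/-- The last deviator, and the number of deviations before his, on the history `past · v`. -/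
noncomputable def devState (past : List V) (v : V) : Option (P × ℕ) :=
  G.revDevState π s past.reverse v

open Classical in
theorem devState_append (past : List V) (u v : V) : G.devState π s (past ++ [u]) v =
    if v = G.punishMove π s (G.devState π s past u) past.length u then G.devState π s past u
    else some (G.owner u, (G.devState π s past u).elim 0 fun x => x.2 + 1) := by
  rw [devState, List.reverse_append, List.reverse_singleton, List.singleton_append, revDevState,
    List.length_reverse]
  rfl

theorem devState_append_of_eq {past : List V} {u v : V}
    (h : v = G.punishMove π s (G.devState π s past u) past.length u) :
    G.devState π s (past ++ [u]) v = G.devState π s past u := by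
  rw [devState_append, if_pos h]

theorem devState_append_of_ne {past : List V} {u v : V}
    (h : v ≠ G.punishMove π s (G.devState π s past u) past.length u) :
    G.devState π s (past ++ [u]) v =
      some (G.owner u, (G.devState π s past u).elim 0 fun x => x.2 + 1) := by
  rw [devState_append, if_neg h]

theorem punishMove_none (n : ℕ) : G.punishMove π s none n (π n) = π (n + 1) := if_pos rfl

theorem devState_range (n : ℕ) : G.devState π s ((List.range n).map π) (π n) = none := by
  induction n with
  | zero => rfl
  | succ n ih =>
    rw [List.range_succ, List.map_append, List.map_singleton, devState_append_of_eq, ih]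
    rw [ih, List.length_map, List.length_range, punishMove_none]

variable {π s}

theorem exists_eq_range_of_devState_eq_none (hπ0 : π 0 = G.init) {past : List V} {v : V}
    (hf : G.IsFinitePlay past v) (h : G.devState π s past v = none) :
    ∃ n, past = (List.range n).map π ∧ v = π n := by
  induction past using List.reverseRecOn generalizing v with
  | nil =>
    refine ⟨0, rfl, ?_⟩
    have := hf.1
    simp only [List.nil_append, List.head?_cons, Option.some.injEq] at this
    rw [this, hπ0]
  | append_singleton past u ih =>
    have hf' : G.IsFinitePlay past u := by
      refine ⟨?_, hf.2.left_of_append⟩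
      rw [← hf.1]
      cases past <;> simp
    by_cases hv : v = G.punishMove π s (G.devState π s past u) past.length u
    · rw [devState_append_of_eq _ _ _ hv] at h
      obtain ⟨n, rfl, rfl⟩ := ih hf' h
      refine ⟨n + 1, by simp [List.range_succ], ?_⟩
      rw [hv, h, List.length_map, List.length_range, punishMove_none]
    · rw [devState_append_of_ne _ _ _ hv] at h
      cases h

/-- The profile in which all players follow the path `π`, and after a deviation the positional
strategies against the last deviator. -/
noncomputable def punishProfile (hπ : G.IsPath π) (hs : ∀ q v, G.Edge v (s q v)) : G.Profile :=
  fun _ =>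
    { move := fun past v => G.punishMove π s (G.devState π s past v) past.length v
      legal := fun past v _ => by
        rcases G.devState π s past v with _ | ⟨q, m⟩
        · by_cases h : v = π past.length
          · rw [h, punishMove_none]
            exact hπ _
          · rw [punishMove, if_neg h]
            exact hs _ _
        · exact hs q v }

variable (hπ : G.IsPath π) (hs : ∀ q v, G.Edge v (s q v))

theorem next_punishProfile (past : List V) (v : V) : G.next (G.punishProfile hπ hs) past v =
    G.punishMove π s (G.devState π s past v) past.length v := rfl

theorem play_punishProfile (hπ0 : π 0 = G.init) : G.play (G.punishProfile hπ hs) = π := by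
  refine (G.eq_play hπ0 fun i => ?_).symm
  rw [next_punishProfile, devState_range, List.length_map, List.length_range, punishMove_none]

/-- The last departure writes its owner into the state, and each later step agrees with the profile
and leaves the state unchanged. This links the declarative notion of last deviator to the recursive
one. -/
theorem IsLastDeviator.devState_eq {past : List V} {v : V} {q : P}
    (h : G.IsLastDeviator (G.punishProfile hπ hs) (past ++ [v]) q) :
    ∃ m, G.devState π s past v = some (q, m) := by
  obtain ⟨a, u, w, b, heq, rfl, hw, hlast⟩ := h
  induction b using List.reverseRecOn generalizing past v with
  | nil =>
    have : past ++ [v] = (a ++ [u]) ++ [w] := by simpa using heq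
    obtain ⟨rfl, hvw⟩ := List.append_inj' this rfl
    simp only [List.cons.injEq, and_true] at hvw
    subst hvw
    exact ⟨_, G.devState_append_of_ne π s hw⟩
  | append_singleton b z ih =>
    have : past ++ [v] = (a ++ u :: w :: b) ++ [z] := by simpa using heq
    obtain ⟨hp, hvz⟩ := List.append_inj' this rfl
    simp only [List.cons.injEq, and_true] at hvz
    subst hvz
    obtain ⟨past', y, rfl⟩ : ∃ past' y, past = past' ++ [y] := by
      rcases List.eq_nil_or_concat' past with rfl | h
      · simp at hp
      · exact h
    obtain ⟨m, hm⟩ := ih hp fun a' u' w' b' h' hlen =>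
      hlast a' u' w' (b' ++ [v]) (by rw [h']; simp) hlen
    refine ⟨m, ?_⟩
    rw [devState_append_of_eq, hm]
    refine hlast past' y v [] (by simp) ?_
    have := congrArg List.length hp
    simp at this
    omega

/-! Continuations of a history in which only one player deviates. -/

variable (π s)

/-- The state after `i` steps of the path `ρ`, which continues the history `past · ρ 0`. -/
noncomputable def stateAlong (past : List V) (ρ : ℕ → V) (i : ℕ) : Option (P × ℕ) :=
  G.devState π s (past ++ (List.range i).map ρ) (ρ i)

/-- From the history `past · ρ 0` on, the path `ρ` follows the punishing profile at step `i`. -/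
def FollowsAt (past : List V) (ρ : ℕ → V) (i : ℕ) : Prop :=
  ρ (i + 1) = G.punishMove π s (G.stateAlong π s past ρ i) (past.length + i) (ρ i)

theorem stateAlong_zero (past : List V) (ρ : ℕ → V) :
    G.stateAlong π s past ρ 0 = G.devState π s past (ρ 0) := by
  rw [stateAlong, List.range_zero, List.map_nil, List.append_nil]

variable {π s}

theorem FollowsAt.stateAlong_succ {past : List V} {ρ : ℕ → V} {i : ℕ}
    (h : G.FollowsAt π s past ρ i) :
    G.stateAlong π s past ρ (i + 1) = G.stateAlong π s past ρ i := by
  rw [stateAlong, List.range_succ, List.map_append, List.map_singleton, ← List.append_assoc,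
    devState_append_of_eq]
  · rfl
  · rw [List.length_append, List.length_map, List.length_range]
    exact h

theorem stateAlong_succ_of_not {past : List V} {ρ : ℕ → V} {i : ℕ}
    (h : ¬ G.FollowsAt π s past ρ i) :
    G.stateAlong π s past ρ (i + 1) =
      some (G.owner (ρ i), (G.stateAlong π s past ρ i).elim 0 fun x => x.2 + 1) := by
  rw [stateAlong, List.range_succ, List.map_append, List.map_singleton, ← List.append_assoc,
    devState_append_of_ne]
  · rfl
  · rw [List.length_append, List.length_map, List.length_range]
    exact h

theorem eq_of_followsAt {past : List V} {ρ ρ' : ℕ → V} {n : ℕ} (h0 : ρ 0 = ρ' 0)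
    (h : ∀ i < n, G.FollowsAt π s past ρ i) (h' : ∀ i < n, G.FollowsAt π s past ρ' i) :
    ∀ i ≤ n, ρ i = ρ' i := by
  refine eq_of_follow (F := fun l v =>
    G.punishMove π s (G.devState π s (past ++ l) v) (past.length + l.length) v) h0
    (fun i hi => ?_) fun i hi => ?_
  · simp only [List.length_map, List.length_range]
    exact h i hi
  · simp only [List.length_map, List.length_range]
    exact h' i hi

theorem followsAt_range (n i : ℕ) :
    G.FollowsAt π s ((List.range n).map π) (fun i => π (n + i)) i := by
  have : (List.range n).map π ++ (List.range i).map (fun i => π (n + i)) =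
      (List.range (n + i)).map π := by
    rw [List.range_add, List.map_append, List.map_map]
    rfl
  rw [FollowsAt, stateAlong, this, devState_range, List.length_map, List.length_range,
    punishMove_none]
  rfl

/-- Only `p` can depart from the profile, so any later change of state names `p` again and merely
raises the count. -/
theorem exists_stateAlong_eq {p : P} {past : List V} {ρ : ℕ → V}
    (h : ∀ i, G.owner (ρ i) ≠ p → G.FollowsAt π s past ρ i) {i n : ℕ}
    (hi : G.stateAlong π s past ρ i = some (p, n)) {j : ℕ} (hij : i ≤ j) :
    ∃ m, n ≤ m ∧ G.stateAlong π s past ρ j = some (p, m) := by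
  induction j, hij using Nat.le_induction with
  | base => exact ⟨n, le_rfl, hi⟩
  | succ j _ ih =>
    obtain ⟨m, hm, hj⟩ := ih
    by_cases hf : G.FollowsAt π s past ρ j
    · exact ⟨m, hm, by rw [hf.stateAlong_succ, hj]⟩
    · rw [G.stateAlong_succ_of_not hf, hj, not_not.1 fun ho => hf (h j ho)]
      exact ⟨m + 1, by omega, rfl⟩

/-- The first deviation in a path on which only `p` deviates. -/
theorem exists_first_deviation {p : P} {past : List V} {ρ : ℕ → V}
    (h : ∀ i, G.owner (ρ i) ≠ p → G.FollowsAt π s past ρ i)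
    (hne : ∃ i, ¬ G.FollowsAt π s past ρ i) :
    ∃ k, (∀ i < k, G.FollowsAt π s past ρ i) ∧ G.owner (ρ k) = p ∧ ∀ j, k < j →
      ∃ m, (G.devState π s past (ρ 0)).elim 0 (fun x => x.2 + 1) ≤ m ∧
        G.stateAlong π s past ρ j = some (p, m) := by
  classical
  have hk := Nat.find_spec hne
  have hmin : ∀ i < Nat.find hne, G.FollowsAt π s past ρ i := fun i hi =>
    not_not.1 (Nat.find_min hne hi)
  have ho : G.owner (ρ (Nat.find hne)) = p := not_not.1 fun ho => hk (h _ ho)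
  have hst : ∀ i ≤ Nat.find hne, G.stateAlong π s past ρ i = G.devState π s past (ρ 0) := by
    intro i hi
    induction i with
    | zero => exact G.stateAlong_zero π s past ρ
    | succ i ih => rw [(hmin i hi).stateAlong_succ, ih (by omega)]
  refine ⟨Nat.find hne, hmin, ho, fun j hj => ?_⟩
  refine G.exists_stateAlong_eq h ?_ hj
  rw [G.stateAlong_succ_of_not hk, ho, hst _ le_rfl]

theorem FollowsAt.eq_of_stateAlong {past : List V} {ρ : ℕ → V} {i : ℕ}
    (h : G.FollowsAt π s past ρ i) {q : P} {m : ℕ}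
    (hs : G.stateAlong π s past ρ i = some (q, m)) : ρ (i + 1) = s q (ρ i) := by
  rw [h, hs, punishMove]

/-- A deviating player receives at most the value of the vertex of his first deviation. -/
theorem rawPayoff_le_of_deviation [Finite V] {p : P} {past : List V} {ρ : ℕ → V}
    (hρ : G.IsPath ρ) (h : ∀ i, G.owner (ρ i) ≠ p → G.FollowsAt π s past ρ i) {val : V → ℝ}
    (hval : ∀ ρ : ℕ → V, G.IsPath ρ → (∀ i, G.owner (ρ i) ≠ p → ρ (i + 1) = s p (ρ i)) →
      G.rawPayoff p ρ ≤ (val (ρ 0) : EReal)) {k : ℕ} (ho : G.owner (ρ k) = p)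
    (hk : ∀ j, k < j → ∃ m, G.stateAlong π s past ρ j = some (p, m)) :
    G.rawPayoff p ρ ≤ (val (ρ k) : EReal) := by
  have := hval (fun i => ρ (i + k)) (fun i => by
    have := hρ (i + k)
    rwa [add_right_comm] at this) fun i hi => by
    -- The deviation itself occurs at step 0, at a vertex of `p`, where nothing is asked of the
    -- coalition; from the next step on the state names `p`.
    have hik : i ≠ 0 := by
      rintro rfl
      simp only [zero_add] at hi
      exact hi ho
    obtain ⟨m, hm⟩ := hk (i + k) (by omega)
    have := (h _ hi).eq_of_stateAlong _ hm
    rwa [add_right_comm] at this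
  rwa [rawPayoff_shift, zero_add] at this

/-- Incentives that make every deviation from the punishing profile unprofitable: on the path
`π`, the constant `c p` is raised by `δ`; afterwards the last deviator receives amounts that
decrease with the number of deviations, and every other player `p` receives `K p`. -/
noncomputable def punishIncentive (π : ℕ → V) (s : P → V → V) (c K : P → ℝ≥0) (δ : ℝ≥0) :
    G.Incentives := fun p past v =>
  open Classical in
  match G.devState π s past v with
  | none => c p + δ
  -- The amounts δ/2, δ/3, … decrease strictly in the number of deviations, and already the first is
  -- below `δ`.
  | some (q, m) => if q = p then δ / (m + 2) else K p

/-- Three cases for the state at the start of the subgame. If nobody has deviated, obeying yields at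
least the value at the departure vertex plus δ, departing at most that value plus δ/2. If `p` is the
last deviator, his punishment goes on whatever he does: the value of the current vertex bounds the
raw payoff below if he obeys and above if he departs, and a further departure lowers his incentive
from δ/(n+2) to at most δ/(n+3). If another player is, obeying earns `K p`, which exceeds any gain
in raw payoff, of at most `2 * B p`, plus δ/2. -/
theorem payoff_lt_of_deviation [Finite V] {val : P → V → ℝ} {R B : P → ℝ} {c K : P → ℝ≥0}
    {δ : ℝ≥0} (hπ0 : π 0 = G.init)
    (hval : ∀ q (ρ : ℕ → V), G.IsPath ρ →
      ((∀ i, G.owner (ρ i) = q → ρ (i + 1) = s q (ρ i)) →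
        (val q (ρ 0) : EReal) ≤ G.rawPayoff q ρ) ∧
      ((∀ i, G.owner (ρ i) ≠ q → ρ (i + 1) = s q (ρ i)) →
        G.rawPayoff q ρ ≤ (val q (ρ 0) : EReal)))
    (hR : ∀ p, G.rawPayoff p π = (R p : EReal)) (hc : ∀ p i, val p (π i) ≤ R p + c p)
    (hB : ∀ p u w, |(G.reward p u w : ℝ)| ≤ B p) (hK : ∀ p, 2 * B p + δ ≤ K p) (hδ : 0 < δ)
    {p : P} {past : List V} {ρ ρ' : ℕ → V} (hf : G.IsFinitePlay past (ρ 0)) (h0 : ρ 0 = ρ' 0)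
    (hρ : G.IsPath ρ) (hρ' : G.IsPath ρ')
    (h : ∀ i, G.owner (ρ i) ≠ p → G.FollowsAt π s past ρ i)
    (h' : ∀ i, G.FollowsAt π s past ρ' i) (hne : ρ ≠ ρ') :
    G.rawPayoff p ρ + limAvg (fun i =>
      (G.punishIncentive π s c K δ p (past ++ (List.range i).map ρ) (ρ i) : ℝ)) <
    G.rawPayoff p ρ' + limAvg (fun i =>
      (G.punishIncentive π s c K δ p (past ++ (List.range i).map ρ') (ρ' i) : ℝ)) := by
  have hδ' : (0 : ℝ) < δ := hδ
  obtain ⟨k, hk, ho, hafter⟩ := G.exists_first_deviation h (by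
    by_contra! hcon
    exact hne (funext fun n => G.eq_of_followsAt (n := n) h0 (fun i _ => hcon i)
      (fun i _ => h' i) n le_rfl))
  have hraw := G.rawPayoff_le_of_deviation hρ h (fun ρ hρ => (hval p ρ hρ).2) ho fun j hj => by
    obtain ⟨m, -, hm⟩ := hafter j hj
    exact ⟨m, hm⟩
  have hpaid : ∀ (m : ℕ) (j : ℕ), G.stateAlong π s past ρ j = some (p, m) →
      (G.punishIncentive π s c K δ p (past ++ (List.range j).map ρ) (ρ j) : ℝ) = δ / (m + 2) :=
    fun m j hj => by
      rw [stateAlong] at hj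
      simp [punishIncentive, hj]
  have hst' : ∀ i, G.stateAlong π s past ρ' i = G.devState π s past (ρ 0) := fun i => by
    induction i with
    | zero => rw [stateAlong_zero, h0]
    | succ i ih => rw [(h' i).stateAlong_succ, ih]
  have hinc : ∀ n : ℕ, n ≤ (G.devState π s past (ρ 0)).elim 0 (fun x => x.2 + 1) →
      limAvg (fun i => (G.punishIncentive π s c K δ p (past ++ (List.range i).map ρ) (ρ i) : ℝ)) ≤
        ((δ / (n + 2) : ℝ) : EReal) := fun n hn => by
    refine limAvg_le_of_eventually (N := k + 1) fun j hj => ?_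
    obtain ⟨m, hm, hm'⟩ := hafter j hj
    rw [hpaid m j hm']
    have : (n : ℝ) ≤ m := by exact_mod_cast hn.trans hm
    gcongr
  cases hs0 : G.devState π s past (ρ 0) with
  | none =>
    have hinc0 := hinc 0 (Nat.zero_le _)
    obtain ⟨n, rfl, hn⟩ := G.exists_eq_range_of_devState_eq_none hπ0 hf hs0
    have hρ'π : ρ' = fun i => π (n + i) := funext fun j =>
      G.eq_of_followsAt (n := j) (by rw [← h0, hn, add_zero]) (fun i _ => h' i)
        (fun i _ => G.followsAt_range n i) j le_rfl
    have hρπ : ρ k = π (n + k) := G.eq_of_followsAt (ρ' := fun i => π (n + i)) (n := k)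
      (by rw [hn, add_zero]) hk (fun i _ => G.followsAt_range n i) k le_rfl
    have hraw' : G.rawPayoff p ρ' = R p := by
      rw [hρ'π, ← hR p, ← G.rawPayoff_shift p π n]
      simp only [add_comm]
    have hinc' : limAvg (fun i => (G.punishIncentive π s c K δ p
        ((List.range n).map π ++ (List.range i).map ρ') (ρ' i) : ℝ)) =
        ((c p + δ : ℝ) : EReal) := by
      rw [← limAvg_const]
      congr 1
      funext i
      have := hst' i
      rw [stateAlong, hs0] at this
      simp [punishIncentive, this]
    rw [hraw', hinc']
    refine (add_le_add hraw hinc0).trans_lt ?_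
    rw [← EReal.coe_add, ← EReal.coe_add, EReal.coe_lt_coe_iff, hρπ]
    have := hc p (n + k)
    simp only [Nat.cast_zero, zero_add]
    linarith
  | some x =>
    obtain ⟨q, n⟩ := x
    by_cases hq : q = p
    · subst hq
      have hinc1 := hinc (n + 1) (by rw [hs0]; rfl)
      have hρraw : G.rawPayoff q ρ ≤ (val q (ρ 0) : EReal) := by
        refine (hval q ρ hρ).2 fun i hi => ?_
        obtain ⟨m, -, hm⟩ := G.exists_stateAlong_eq h
          ((G.stateAlong_zero π s past ρ).trans hs0) (Nat.zero_le i)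
        exact (h i hi).eq_of_stateAlong _ hm
      have hρ'raw : (val q (ρ 0) : EReal) ≤ G.rawPayoff q ρ' := by
        rw [h0]
        exact (hval q ρ' hρ').1 fun i _ => (h' i).eq_of_stateAlong _ ((hst' i).trans hs0)
      have hinc' : limAvg (fun i => (G.punishIncentive π s c K δ q
          (past ++ (List.range i).map ρ') (ρ' i) : ℝ)) = ((δ / (n + 2) : ℝ) : EReal) := by
        rw [← limAvg_const]
        congr 1
        funext i
        have := hst' i
        rw [stateAlong, hs0] at this
        simp [punishIncentive, this]
      refine (add_le_add hρraw hinc1).trans_lt (lt_of_lt_of_le ?_ (add_le_add hρ'raw hinc'.ge))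
      rw [← EReal.coe_add, ← EReal.coe_add, EReal.coe_lt_coe_iff]
      push_cast
      gcongr
      linarith
    · have hinc0 := hinc 0 (Nat.zero_le _)
      have hρraw : G.rawPayoff p ρ ≤ (B p : EReal) :=
        limAvg_le_of_eventually (N := 0) fun i _ => (abs_le.1 (hB p _ _)).2
      have hρ'raw : ((-B p : ℝ) : EReal) ≤ G.rawPayoff p ρ' :=
        le_limAvg_of_eventually (N := 0) fun i _ => (abs_le.1 (hB p _ _)).1
      have hinc' : limAvg (fun i => (G.punishIncentive π s c K δ p
          (past ++ (List.range i).map ρ') (ρ' i) : ℝ)) = ((K p : ℝ) : EReal) := by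
        rw [← limAvg_const]
        congr 1
        funext i
        have := hst' i
        rw [stateAlong, hs0] at this
        simp [punishIncentive, this, hq]
      refine (add_le_add hρraw hinc0).trans_lt (lt_of_lt_of_le ?_ (add_le_add hρ'raw hinc'.ge))
      rw [← EReal.coe_add, ← EReal.coe_add, EReal.coe_lt_coe_iff]
      have := hK p
      simp only [Nat.cast_zero, zero_add]
      linarith

end Punish

end Arena

/-! ### The perfectly-incentivised strategy profile -/

namespace Arena

variable {P V : Type*} (G : Arena P V)

theorem reward_le_maxReward [Finite P] [Finite V] (p : P) {u w : V} (h : G.Edge u w) :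
    (G.reward p u w : ℝ) ≤ G.maxReward := by
  refine le_csSup (Set.Finite.bddAbove ?_) ⟨p, u, w, h, rfl⟩
  refine (Set.finite_range fun x : P × V × V => (G.reward x.1 x.2.1 x.2.2 : ℝ)).subset ?_
  rintro _ ⟨p, u, w, -, rfl⟩
  exact ⟨(p, u, w), rfl⟩

section Punish

variable {π : ℕ → V} {s : P → V → V} (hπ : G.IsPath π) (hs : ∀ q v, G.Edge v (s q v))

open Classical in
/-- The incentives of the perfectly-incentivised strategy profile that follows `π` and pays `c`
along it. -/
noncomputable def pspIncentive (c : P → ℝ≥0) : G.Incentives := fun p past v =>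
  if G.devState π s past v = none then c p
  else if G.IsRewarded (G.punishProfile hπ hs) p past v then
    -- A rewarded history has a nonempty past, so the default `v` is never taken; on edges the
    -- difference is positive, so nothing is truncated.
    Real.toNNReal (G.maxReward + 1 - G.reward p (past.getLast?.getD v) v)
  else 0

theorem IsRewarded.exists_devState_eq {p : P} {past : List V} {v : V}
    (h : G.IsRewarded (G.punishProfile hπ hs) p past v) :
    ∃ q m, p ≠ q ∧ G.devState π s past v = some (q, m) := by
  obtain ⟨a, u, q, rfl, -, hq, -, hpq, hv⟩ := h
  obtain ⟨m, hm⟩ := IsLastDeviator.devState_eq G hπ hs hq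
  exact ⟨q, m, hpq, by rw [devState_append_of_eq _ _ _ hv, hm]⟩

theorem pspIncentive_range (c : P → ℝ≥0) (p : P) (n : ℕ) :
    G.pspIncentive hπ hs c p ((List.range n).map π) (π n) = c p :=
  if_pos (G.devState_range π s n)

/-- A rewarded move is the prescribed one and leaves the state alone, so the state still names a
player other than the rewarded one. -/
theorem pspIncentive_of_devState_eq (c : P → ℝ≥0) {p : P} {past : List V} {v : V} {m : ℕ}
    (h : G.devState π s past v = some (p, m)) : G.pspIncentive hπ hs c p past v = 0 := by
  rw [pspIncentive, if_neg (by simp [h]), if_neg]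
  intro hr
  obtain ⟨q, m', hpq, hq⟩ := IsRewarded.exists_devState_eq G hπ hs hr
  rw [h] at hq
  simp only [Option.some.injEq, Prod.mk.injEq] at hq
  exact hpq hq.1

theorem isPSP_punishProfile [Finite P] [Finite V] (hopt : ∀ q, G.IsOptimalPositional q (s q))
    (hπ0 : π 0 = G.init) (c : P → ℝ≥0) :
    G.IsPSP (G.punishProfile hπ hs) (G.pspIncentive hπ hs c) where
  const p _ := ⟨c p, fun n => by rw [play_punishProfile G hπ hs hπ0, pspIncentive_range]⟩
  punish := ⟨s, hopt, fun past v q _ hq => by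
    obtain ⟨m, hm⟩ := IsLastDeviator.devState_eq G hπ hs hq
    rw [next_punishProfile, hm, punishMove]⟩
  reward p _ past u v hr := by
    obtain ⟨q, m, -, hq⟩ := IsRewarded.exists_devState_eq G hπ hs hr
    rw [pspIncentive, if_neg (by simp [hq]), if_pos hr]
    obtain ⟨a, u', -, hau, -, -, -, -, rfl⟩ := hr
    obtain ⟨rfl, huu⟩ := List.append_inj' hau rfl
    simp only [List.cons.injEq, and_true] at huu
    subst huu
    have := G.reward_le_maxReward p (G.edge_next (G.punishProfile hπ hs) past u)
    simp only [List.getLast?_append, List.getLast?_singleton, Option.some_or, Option.getD_some]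
    rw [Real.coe_toNNReal _ (by linarith)]
    ring
  zero p _ past v hd hr := by
    rw [pspIncentive, if_neg, if_neg hr]
    intro h
    refine hd.2 ?_
    rw [play_punishProfile G hπ hs hπ0]
    exact G.exists_eq_range_of_devState_eq_none hπ0 hd.1 h

theorem incentive_eq_of_forall {γ : G.Incentives} {p : P} {c : ℝ≥0}
    (h : ∀ n, γ p ((List.range n).map π) (π n) = c) : G.incentive γ p π = ((c : ℝ) : EReal) := by
  rw [incentive, ← limAvg_const]
  simp only [h]

/-- If `p` deviates in the subgame after the history `past · v`, all other players still follow the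
punishing profile. -/
theorem followsAt_play_deviate_subProfile {past : List V} {v : V} {p : P}
    (τ : (G.startAt v).Strategy p) (i : ℕ)
    (hi : G.owner ((G.startAt v).play ((G.startAt v).deviate
      (G.subProfile (G.punishProfile hπ hs) past v) p τ) i) ≠ p) :
    G.FollowsAt π s past ((G.startAt v).play ((G.startAt v).deviate
      (G.subProfile (G.punishProfile hπ hs) past v) p τ)) i := by
  have h1 := (G.startAt v).play_succ ((G.startAt v).deviate
    (G.subProfile (G.punishProfile hπ hs) past v) p τ) i
  refine h1.trans (((G.startAt v).next_deviate_of_ne _ τ _ hi).trans ?_)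
  change G.punishMove π s _ (past ++ _).length _ = _
  rw [List.length_append, List.length_map, List.length_range]
  rfl

theorem followsAt_play_subProfile {past : List V} {v : V} (i : ℕ) :
    G.FollowsAt π s past
      ((G.startAt v).play (G.subProfile (G.punishProfile hπ hs) past v)) i := by
  have h1 := (G.startAt v).play_succ (G.subProfile (G.punishProfile hπ hs) past v) i
  refine h1.trans ?_
  change G.punishMove π s _ (past ++ _).length _ = _
  rw [List.length_append, List.length_map, List.length_range]
  rfl

theorem followsAt_play_deviate {p : P} (τ : G.Strategy p) (i : ℕ)
    (hi : G.owner (G.play (G.deviate (G.punishProfile hπ hs) p τ) i) ≠ p) :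
    G.FollowsAt π s [] (G.play (G.deviate (G.punishProfile hπ hs) p τ)) i := by
  have h1 := G.play_succ (G.deviate (G.punishProfile hπ hs) p τ) i
  rw [next_deviate_of_ne _ _ _ _ hi, next_punishProfile, List.length_map, List.length_range] at h1
  rw [FollowsAt, List.length_nil, zero_add]
  exact h1

/-- After his first departure, at some `π k`, a follower is paid no incentive and is held to `val p
(π k)`, which `hc` bounds by his payoff on the play. -/
theorem isISP_punishProfile [Fintype P] [Finite V] {val : P → V → ℝ} {R : P → ℝ} {c : P → ℝ≥0}
    (hπ0 : π 0 = G.init)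
    (hval : ∀ q (ρ : ℕ → V), G.IsPath ρ → (∀ i, G.owner (ρ i) ≠ q → ρ (i + 1) = s q (ρ i)) →
        G.rawPayoff q ρ ≤ (val q (ρ 0) : EReal))
    (hR : ∀ p, G.rawPayoff p π = (R p : EReal)) (hc : ∀ p i, val p (π i) ≤ R p + c p) :
    G.IsISP (G.punishProfile hπ hs) (G.pspIncentive hπ hs c) := by
  intro p hp τ
  rw [payoff_of_ne _ _ hp, payoff_of_ne _ _ hp, play_punishProfile G hπ hs hπ0, hR,
    G.incentive_eq_of_forall (G.pspIncentive_range hπ hs c p)]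
  set ρ := G.play (G.deviate (G.punishProfile hπ hs) p τ)
  have h : ∀ i, G.owner (ρ i) ≠ p → G.FollowsAt π s [] ρ i := G.followsAt_play_deviate hπ hs τ
  have h0 : ρ 0 = π (0 + 0) := hπ0.symm
  by_cases hne : ∃ i, ¬ G.FollowsAt π s [] ρ i
  · obtain ⟨k, hk, ho, hafter⟩ := G.exists_first_deviation h hne
    have hraw := G.rawPayoff_le_of_deviation (ρ := ρ) (G.isPath_play _) h (hval p) ho fun j hj => by
      obtain ⟨m, -, hm⟩ := hafter j hj
      exact ⟨m, hm⟩
    have hinc : G.incentive (G.pspIncentive hπ hs c) p ρ ≤ ((0 : ℝ) : EReal) := by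
      refine limAvg_le_of_eventually (N := k + 1) fun j hj => ?_
      obtain ⟨m, -, hm⟩ := hafter j hj
      have hm' : G.devState π s ((List.range j).map ρ) (ρ j) = some (p, m) := hm
      rw [G.pspIncentive_of_devState_eq hπ hs c hm', NNReal.coe_zero]
    have hρπ : ρ k = π (0 + k) := G.eq_of_followsAt (ρ' := fun i => π (0 + i)) (n := k)
      h0 hk (fun i _ => G.followsAt_range 0 i) k le_rfl
    refine (add_le_add hraw hinc).trans ?_
    rw [← EReal.coe_add, ← EReal.coe_add, EReal.coe_le_coe_iff, hρπ, add_zero]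
    exact hc p _
  · push Not at hne
    have hρπ : ρ = π := funext fun j => by
      have := G.eq_of_followsAt (ρ' := fun i => π (0 + i)) (n := j)
        h0 (fun i _ => hne i) (fun i _ => G.followsAt_range 0 i) j le_rfl
      rwa [zero_add] at this
    rw [hρπ, hR, G.incentive_eq_of_forall (G.pspIncentive_range hπ hs c p)]

theorem payoff_leader [Fintype P] {γ : G.Incentives} {R : P → ℝ} {c : P → ℝ≥0}
    (hR : ∀ p, G.rawPayoff p π = (R p : EReal))
    (hγ : ∀ p n, γ p ((List.range n).map π) (π n) = c p) :
    open Classical in G.payoff γ G.leader π =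
      ((R G.leader - ∑ q ∈ Finset.univ.filter (fun q => q ≠ G.leader), (c q : ℝ) : ℝ) :
        EReal) := by
  rw [payoff, if_pos rfl, hR, EReal.coe_sub, EReal.coe_sum_real]
  simp only [fun q => G.incentive_eq_of_forall (hγ q)]

end Punish

end Arena

/-! ### Assembly of the two equilibria -/

theorem mainTheorem5 {P V : Type*} [Fintype P] [Finite V] (G : Arena P V) (ε : ℝ) (hε : 0 < ε) :
    ∃ (σ : G.Profile) (γ γ' : G.Incentives),
      G.IsWellBehaved σ ∧ G.IsPSP σ γ ∧ G.IsIncentiveEquilibrium σ γ ∧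
      (∀ p, p ≠ G.leader → ∀ n,
        (γ' p ((List.range n).map (G.play σ)) (G.play σ n) : ℝ) =
          γ p ((List.range n).map (G.play σ)) (G.play σ n) + ε / Fintype.card P) ∧
      G.IsEpsIncentiveEquilibrium ε σ γ' ∧
      G.IsSubgamePerfect σ γ' ∧
      G.IsSecureSubgamePerfect σ γ' ∧
      (∀ p, p ≠ G.leader → ∀ τ : G.Strategy p, G.play (G.deviate σ p τ) ≠ G.play σ →
        G.payoff γ' p (G.play (G.deviate σ p τ)) < G.payoff γ' p (G.play σ)) := by
  classical
  choose s hopt using G.exists_isOptimalPositional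
  have hs : ∀ q v, G.Edge v (s q v) := fun q => (hopt q).1
  choose val hval using fun q => (hopt q).2
  replace hval : ∀ q (ρ : ℕ → V), G.IsPath ρ →
      ((∀ i, G.owner (ρ i) = q → ρ (i + 1) = s q (ρ i)) →
        (val q (ρ 0) : EReal) ≤ G.rawPayoff q ρ) ∧
      ((∀ i, G.owner (ρ i) ≠ q → ρ (i + 1) = s q (ρ i)) →
        G.rawPayoff q ρ ≤ (val q (ρ 0) : EReal)) := fun q ρ hρ =>
    ⟨(hval q ρ hρ).1, fun h => limAvg_le_of_neg ((hval q ρ hρ).2 h)⟩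
  obtain ⟨π, R, c, hπ0, hπ, hfreq, hR, hc, hbest⟩ := G.exists_optimal_play val
  choose B hB using G.exists_abs_reward_le
  have hcard : (0 : ℝ) < Fintype.card P := by
    exact_mod_cast Fintype.card_pos_iff.2 ⟨G.leader⟩
  obtain ⟨δ, hδ⟩ : ∃ δ : ℝ≥0, (δ : ℝ) = ε / Fintype.card P := ⟨⟨_, (div_pos hε hcard).le⟩, rfl⟩
  have hδ0 : 0 < δ := by
    rw [← NNReal.coe_pos, hδ]
    exact div_pos hε hcard
  let K : P → ℝ≥0 := fun p => Real.toNNReal (2 * B p + δ)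
  have hK : ∀ p, 2 * B p + δ ≤ K p := fun p => Real.le_coe_toNNReal _
  let σ := G.punishProfile hπ hs
  let γ := G.pspIncentive hπ hs c
  let γ' := G.punishIncentive π s c K δ
  have hplay : G.play σ = π := G.play_punishProfile hπ hs hπ0
  have hγ : ∀ p n, γ p ((List.range n).map π) (π n) = c p := G.pspIncentive_range hπ hs c
  have hγ' : ∀ p n, γ' p ((List.range n).map π) (π n) = c p + δ := fun p n => by
    simp only [γ', Arena.punishIncentive, Arena.devState_range]
  have hstrict : ∀ p, p ≠ G.leader → ∀ τ : G.Strategy p, G.play (G.deviate σ p τ) ≠ G.play σ →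
      G.payoff γ' p (G.play (G.deviate σ p τ)) < G.payoff γ' p (G.play σ) := fun p hp τ hne => by
    rw [Arena.payoff_of_ne _ _ hp, Arena.payoff_of_ne _ _ hp]
    refine G.payoff_lt_of_deviation (past := []) hπ0 hval hR hc hB hK hδ0 ⟨rfl, ?_⟩ rfl
      (G.isPath_play _) (G.isPath_play _) (G.followsAt_play_deviate hπ hs τ) (fun i => ?_) hne
    · exact List.isChain_singleton _
    · have := G.followsAt_range (π := π) (s := s) 0 i
      simpa only [hplay, zero_add, List.range_zero, List.map_nil] using this
  have hISP' : G.IsISP σ γ' := fun p hp τ => by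
    by_cases hne : G.play (G.deviate σ p τ) = G.play σ
    · rw [hne]
    · exact (hstrict p hp τ hne).le
  have hsub : ∀ past v, G.IsFinitePlay past v → ∀ p, p ≠ G.leader →
      ∀ τ : (G.startAt v).Strategy p,
      (G.startAt v).play ((G.startAt v).deviate (G.subProfile σ past v) p τ) ≠
        (G.startAt v).play (G.subProfile σ past v) →
      (G.startAt v).payoff (G.subIncentives γ' past v) p
        ((G.startAt v).play ((G.startAt v).deviate (G.subProfile σ past v) p τ)) <
      (G.startAt v).payoff (G.subIncentives γ' past v) p
        ((G.startAt v).play (G.subProfile σ past v)) := fun past v hf p hp τ hne => by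
    rw [(G.startAt v).payoff_of_ne _ hp, (G.startAt v).payoff_of_ne _ hp]
    exact G.payoff_lt_of_deviation hπ0 hval hR hc hB hK hδ0 hf rfl
      ((G.startAt v).isPath_play _) ((G.startAt v).isPath_play _)
      (G.followsAt_play_deviate_subProfile hπ hs τ) (G.followsAt_play_subProfile hπ hs) hne
  -- A deviation either leaves the play, and hence all payoffs, unchanged or is strictly worse for
  -- the deviator, so the equality clause of security is immediate.
  have hsec : G.IsSecureSubgamePerfect σ γ' := fun past v hf => by
    refine ⟨fun p hp τ => ?_, fun p hp τ => ?_⟩ <;>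
    by_cases hne : (G.startAt v).play ((G.startAt v).deviate (G.subProfile σ past v) p τ) =
        (G.startAt v).play (G.subProfile σ past v)
    · rw [hne]
    · exact (hsub past v hf p hp τ hne).le
    · exact Or.inr ⟨by rw [hne], fun q _ => by rw [hne]⟩
    · exact Or.inl (hsub past v hf p hp τ hne)
  -- Every ISP meets the value bounds at all vertices of its play, so it is a competitor in the
  -- leader's optimisation.
  have hupper : ∀ (σ' : G.Profile) (γ₁ : G.Incentives), G.IsISP σ' γ₁ →
      G.payoff γ₁ G.leader (G.play σ') ≤ G.payoff γ G.leader (G.play σ) := fun σ' γ₁ h => by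
    rw [hplay, G.payoff_leader hR hγ, Arena.payoff, if_pos rfl]
    exact hbest _ rfl (G.isPath_play σ') _ fun p hp => ⟨G.zero_le_incentive _ _ _,
      h.le_payoff G hp (hs p) fun ρ hρ => (hval p ρ hρ).1⟩
  refine ⟨σ, γ, γ', ?_, G.isPSP_punishProfile hπ hs hopt hπ0 c,
    ⟨G.isISP_punishProfile hπ hs hπ0 (fun q ρ hρ => (hval q ρ hρ).2) hR hc, hupper⟩, ?_,
    ⟨hISP', fun σ' γ₁ h => ?_⟩, fun past v hf => (hsec past v hf).1, hsec, hstrict⟩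
  · intro u w _
    rw [hplay]
    exact hfreq u w
  · intro p _ n
    rw [hplay, hγ, hγ', ← hδ, NNReal.coe_add]
  · refine (EReal.sub_le_sub (hupper σ' γ₁ h) le_rfl).trans ?_
    rw [hplay, G.payoff_leader hR hγ, G.payoff_leader (c := fun p => c p + δ) hR hγ',
      ← EReal.coe_sub, EReal.coe_le_coe_iff]
    -- The leader's extra cost is δ for each follower, and there are at most |P| of them.
    have h1 : ((Finset.univ.filter fun q => q ≠ G.leader).card : ℝ) * δ ≤ ε := by
      have h2 : ((Finset.univ.filter fun q => q ≠ G.leader).card : ℝ) ≤ Fintype.card P := by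
        exact_mod_cast Finset.card_le_univ _
      calc _ ≤ (Fintype.card P : ℝ) * δ := mul_le_mul_of_nonneg_right h2 δ.2
        _ = ε := by rw [hδ]; field_simp
    simp only [NNReal.coe_add, Finset.sum_add_distrib, Finset.sum_const, nsmul_eq_mul]
    linarith
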